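/- Let $C^\infty(\mathbb R)$ be the algebra of smooth functions on $\mathbb R$ with values in $\mathbb R$ or $\mathbb C$, with the Fréchet topology of locally uniform convergence of all derivatives. For an ideal $\mathcal I$ of $C^\infty(\mathbb R)$ and $x\in\mathbb R$ let $\mu(x)\in\mathbb N_0\cup\{\infty\}$ be the largest $p$ such that $f^{(j)}(x)=0$ for all $f\in\mathcal I$ and all $j<p$, let $Z(\mathcal I)=\{x:\mu(x)>0\}$, and call $\sum_{x\in J}\mu(x)$ the number of zeroes of $\mathcal I$ in $J\subseteq\mathbb R$. **Theorem.** Let $\mathcal I$ be a closed ideal of $C^\infty(\mathbb R)$ such that $K=Z(\mathcal I)$ is compact. For $n\in\mathbb N_0$, $F\in C^\infty(\mathbb R)$ and $f\in C^\infty(\mathbb R)/\mathcal I$ put $$\|F\|_n=\sup\{|F^{(j)}(x)|: 0\le j\le n,\ x\in \operatorname{conv}(K)\cup[-n,n]\},\qquad |||f|||_n=\inf\{\|F\|_n: F\text{ represents } f\},$$ where $\operatorname{conv}(K)$ is the convex hull of $K$. Let $n\in\mathbb N_0$ and suppose that there are real numbers $r\ge1$ and $\gamma\ge1$ such that for all integers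 $m,k\ge 1$ there are $c>0$ and $\varepsilon_0\in(0,1)$ such that for all $x\in K$ and $0<\varepsilon<\varepsilon_0$ at least one of the following holds: 1. $(x-\varepsilon^r,x+\varepsilon^r)$ contains at most $n+1$ zeroes of $\mathcal I$ (counted with multiplicity); 2. there is $y\in K\cap(x-\varepsilon,x+\varepsilon)$ such that $$|P^{(j)}(y)|\le \frac{c}{\varepsilon^{\gamma m}}\,\sup\{|P(t)|: t\in K\cap(y-\varepsilon,y+\varepsilon)\}$$ for all polynomials $P$ of degree $\le k$ and all $j\in\{0,\dots,m\}$. Then $|||\cdot|||_n$ is a dominating norm on $C^\infty(\mathbb R)/\mathcal I$: $|||f|||_n=0$ only for $f=0$, and for every $m\ge n$ there are $k\ge m$ and $c>0$ such that $$|||f|||_m^2\le c\,|||f|||_k\,|||f|||_n\qquad\text{for all } f\in C^\infty(\mathbb R)/\mathcal I .$$ -/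

import Mathlib

open Set Polynomial
open scoped ContDiff Topology

/-- The algebra `C^∞(ℝ)` of smooth functions on the real line with values in `𝕜` (`= ℝ` or `ℂ`),
with pointwise operations. -/
def smoothFunctions (𝕜 : Type*) [RCLike 𝕜] : Subalgebra 𝕜 (ℝ → 𝕜) where
  carrier := {f | ContDiff ℝ ∞ f}
  mul_mem' := fun {f g} (hf : ContDiff ℝ ∞ f) (hg : ContDiff ℝ ∞ g) =>
    show ContDiff ℝ ∞ (f * g) from hf.mul hg
  add_mem' := fun {f g} (hf : ContDiff ℝ ∞ f) (hg : ContDiff ℝ ∞ g) =>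
    show ContDiff ℝ ∞ (f + g) from hf.add hg
  algebraMap_mem' := fun a => show ContDiff ℝ ∞ (fun _ : ℝ => a) from contDiff_const

/-- The `j`-th derivative of a smooth function, as a continuous map. -/
noncomputable def smoothDeriv {𝕜 : Type*} [RCLike 𝕜] (f : smoothFunctions 𝕜) (j : ℕ) : C(ℝ, 𝕜) where
  toFun := iteratedDeriv j (f : ℝ → 𝕜)
  continuous_toFun :=
    ContDiff.continuous_iteratedDeriv j (show ContDiff ℝ ∞ (f : ℝ → 𝕜) from f.2)
      (by exact_mod_cast le_top)

/-- The Fréchet topology of `C^∞(ℝ)`: locally uniform convergence of all derivatives (`C(ℝ, 𝕜)`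
carries the compact-open topology, and the sequences of derivatives the product topology). It
has to be named explicitly, since the subtype topology on `smoothFunctions 𝕜` is that of
pointwise convergence. -/
@[reducible] noncomputable def smoothTopology (𝕜 : Type*) [RCLike 𝕜] : TopologicalSpace (smoothFunctions 𝕜) :=
  TopologicalSpace.induced (fun (f : smoothFunctions 𝕜) (j : ℕ) => smoothDeriv f j) inferInstance

/-- The multiplicity `μ(x) ∈ ℕ ∪ {∞}` of `x` as a zero of the ideal `I`: the largest `p` such that
all derivatives of order `< p` of all elements of `I` vanish at `x`. -/
noncomputable def zeroMultiplicity {𝕜 : Type*} [RCLike 𝕜] (I : Ideal (smoothFunctions 𝕜)) (x : ℝ) :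
    ℕ∞ :=
  sSup {p : ℕ∞ | ∀ f ∈ I, ∀ j : ℕ, (j : ℕ∞) < p → iteratedDeriv j (f : ℝ → 𝕜) x = 0}

/-- The zero set `Z(I) = {x : μ(x) > 0}`. -/
def zeroSet {𝕜 : Type*} [RCLike 𝕜] (I : Ideal (smoothFunctions 𝕜)) : Set ℝ :=
  {x | 0 < zeroMultiplicity I x}

/-- The number of zeroes of `I` in `J`, counted with multiplicity: the sum of the `μ(x)` over
`x ∈ J`, i.e. the supremum of all finite partial sums. -/
noncomputable def numZeros {𝕜 : Type*} [RCLike 𝕜] (I : Ideal (smoothFunctions 𝕜)) (J : Set ℝ) : ℕ∞ :=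
  ⨆ s : {s : Finset ℝ // (s : Set ℝ) ⊆ J}, ∑ x ∈ s.1, zeroMultiplicity I x

/-- The seminorm `‖F‖_n = sup {|F^{(j)}(x)| : 0 ≤ j ≤ n, x ∈ conv(K) ∪ [-n, n]}`
(used for compact `K`). -/
noncomputable def smoothNorm {𝕜 : Type*} [RCLike 𝕜] (K : Set ℝ) (n : ℕ) (F : smoothFunctions 𝕜) : ℝ :=
  sSup {a : ℝ | ∃ j ≤ n, ∃ x ∈ convexHull ℝ K ∪ Icc (-(n : ℝ)) n,
    a = ‖iteratedDeriv j (F : ℝ → 𝕜) x‖}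

/-- The quotient seminorm `|||f|||_n = inf {‖F‖_n : F represents f}` on `C^∞(ℝ) / I`, with
`‖·‖_n` taken for `K = Z(I)`. -/
noncomputable def quotientNorm {𝕜 : Type*} [RCLike 𝕜] (I : Ideal (smoothFunctions 𝕜)) (n : ℕ)
    (f : smoothFunctions 𝕜 ⧸ I) : ℝ :=
  sInf {a : ℝ | ∃ F : smoothFunctions 𝕜, Ideal.Quotient.mk I F = f ∧ a = smoothNorm (zeroSet I) n F}

/-- The `n`-th of an increasing sequence of seminorms is dominating. -/
def IsDominating {X : Type*} (p : ℕ → X → ℝ) (n : ℕ) : Prop :=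
  ∀ m ≥ n, ∃ k ≥ m, ∃ c > (0 : ℝ), ∀ x : X, p m x ^ 2 ≤ c * p k x * p n x

/-- The local Markov inequality at `y ∈ K` on the scale `ε`, with factor `A`, for all polynomials of
degree at most `k` and all derivatives of order at most `m`. -/
def LocalMarkov (𝕜 : Type*) [RCLike 𝕜] (K : Set ℝ) (m k : ℕ) (A ε y : ℝ) : Prop :=
  ∀ P : 𝕜[X], P.natDegree ≤ k → ∀ j ≤ m,
    ‖(derivative^[j] P).eval (y : 𝕜)‖ ≤
      A * sSup {a : ℝ | ∃ t ∈ K ∩ Ioo (y - ε) (y + ε), a = ‖P.eval (t : 𝕜)‖}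

/-- Near each point of `Z(I)`, on all small scales, there are either few zeroes or the zero set
satisfies a local Markov inequality. -/
def FewZerosOrMarkov {𝕜 : Type*} [RCLike 𝕜] (I : Ideal (smoothFunctions 𝕜)) (n : ℕ) : Prop :=
  ∃ r ≥ (1 : ℝ), ∃ γ ≥ (1 : ℝ), ∀ m k : ℕ, 1 ≤ m → 1 ≤ k →
    ∃ c > (0 : ℝ), ∃ ε₀ ∈ Ioo (0 : ℝ) 1, ∀ x ∈ zeroSet I, ∀ ε : ℝ, 0 < ε → ε < ε₀ →
      numZeros I (Ioo (x - ε ^ r) (x + ε ^ r)) ≤ (n : ℕ∞) + 1 ∨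
      ∃ y ∈ zeroSet I ∩ Ioo (x - ε) (x + ε),
        LocalMarkov 𝕜 (zeroSet I) m k (c / ε ^ (γ * (m : ℝ))) ε y

/-! ### Hadamard quotients of smooth functions. -/

section Hadamard

variable {𝕜 : Type*} [RCLike 𝕜]

/-! Fix two representatives of the class, `F` with small `n`-th norm and `G` with small `k`-th norm,
and a scale ε. Cover the zero set K by cells of length about ε^r. Where the ideal has at most n + 1
zeroes near a cell, Hermite interpolation of `F` at these zeroes is a local representative; all its
derivatives are bounded by those of `F` of order at most n on conv(K). Otherwise a Markov inequality
holds at some y near the cell. Applied to a Taylor polynomial of `G` at y it bounds the derivatives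
of `G` there by sup |G| over K, up to a power of ε times the `k`-th norm of `G`. Since `G` = `F` on
K, this sup is controlled by `F`, and `G` itself is the local representative
(`exists_local_representative`).

A partition of unity glues the pieces at the cost of a power of 1/ε. That the result still
represents the class is spectral synthesis: a closed ideal contains every function with the
prescribed zero multiplicities (`mem_of_vanishesLike`).

With p_m the quotient norms, this gives p_m ≤ C(ε^(-AQ) p_n + ε^Q p_k) for all small ε. The Markov
factor has an exponent linear in the order, so A does not depend on m
(`exists_quotientNorm_le_scale`). Optimizing in ε yields p_m^(A+1) ≤ D p_n p_k^A. Because A is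
fixed, this can be iterated until p_n carries at least half of the total exponent, which implies the
dominating inequality (`isDominating_of_pow_le`). If p_n(f) = 0, all p_m(f) vanish, and f = 0
because the ideal is closed. -/

theorem ContDiff.hasDerivAt_iteratedDeriv {F : ℝ → 𝕜} (hF : ContDiff ℝ ∞ F) (n : ℕ) (t : ℝ) :
    HasDerivAt (iteratedDeriv n F) (iteratedDeriv (n + 1) F t) t := by
  rw [iteratedDeriv_succ]
  exact ((hF.differentiable_iteratedDeriv n (by exact_mod_cast WithTop.coe_lt_top n)) t).hasDerivAt

theorem ContDiff.continuous_iteratedDeriv_infty {F : ℝ → 𝕜} (hF : ContDiff ℝ ∞ F) (n : ℕ) :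
    Continuous (iteratedDeriv n F) :=
  hF.continuous_iteratedDeriv n (by exact_mod_cast le_top)

/-- Reads smoothness and all iterated derivatives off an explicit chain of derivatives. It serves
for Hadamard quotients, for polynomials on the real line and for derivatives of smooth functions. -/
theorem contDiff_of_hasDerivAt_succ {G : ℕ → ℝ → 𝕜}
    (h : ∀ n t, HasDerivAt (G n) (G (n + 1) t) t) :
    ContDiff ℝ ∞ (G 0) ∧ ∀ n, iteratedDeriv n (G 0) = G n := by
  have key : ∀ n, iteratedDeriv n (G 0) = G n := by
    intro n
    induction n with
    | zero => simp
    | succ n ih =>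
      rw [iteratedDeriv_succ, ih]
      funext t
      exact (h n t).deriv
  refine ⟨contDiff_of_differentiable_iteratedDeriv fun m _ => ?_, key⟩
  rw [key]
  exact fun t => (h m t).differentiableAt

/-- The derivatives of the Hadamard quotient of `F` at `x`. -/
noncomputable def hadamardDeriv (F : ℝ → 𝕜) (x : ℝ) (n : ℕ) (t : ℝ) : 𝕜 :=
  ∫ s in (0 : ℝ)..1, s ^ n • iteratedDeriv (n + 1) F (x + s * (t - x))

/-- Differentiation under the integral sign; each derivative in t brings out one more factor s. -/
theorem hasDerivAt_hadamardDeriv {F : ℝ → 𝕜} (hF : ContDiff ℝ ∞ F) (x : ℝ) (n : ℕ) (t : ℝ) :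
    HasDerivAt (hadamardDeriv F x n) (hadamardDeriv F x (n + 1) t) t := by
  have hc : ∀ m k : ℕ, ∀ u : ℝ,
      Continuous fun s : ℝ => s ^ m • iteratedDeriv k F (x + s * (u - x)) := fun m k u =>
    (continuous_pow m).smul ((hF.continuous_iteratedDeriv_infty k).comp (by fun_prop))
  obtain ⟨B, hB⟩ : ∃ B, ∀ p ∈ Icc (0 : ℝ) 1 ×ˢ Metric.closedBall t 1,
      ‖p.1 ^ (n + 1) • iteratedDeriv (n + 2) F (x + p.1 * (p.2 - x))‖ ≤ B := by
    apply (isCompact_Icc.prod (isCompact_closedBall t 1)).exists_bound_of_continuousOn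
    apply Continuous.continuousOn
    exact (continuous_fst.pow _).smul ((hF.continuous_iteratedDeriv_infty _).comp (by fun_prop))
  refine (intervalIntegral.hasDerivAt_integral_of_dominated_loc_of_deriv_le
    (F := fun u s => s ^ n • iteratedDeriv (n + 1) F (x + s * (u - x)))
    (F' := fun u s => s ^ (n + 1) • iteratedDeriv (n + 2) F (x + s * (u - x)))
    (bound := fun _ => B) (Metric.closedBall_mem_nhds t one_pos) ?_ ?_ ?_ ?_ ?_ ?_).2
  · exact Filter.Eventually.of_forall fun u => (hc n (n + 1) u).aestronglyMeasurable
  · exact (hc n (n + 1) t).intervalIntegrable _ _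
  · exact (hc (n + 1) (n + 2) t).aestronglyMeasurable
  · refine Filter.Eventually.of_forall fun s hs u hu => ?_
    rw [uIoc_of_le zero_le_one] at hs
    exact hB (s, u) ⟨⟨hs.1.le, hs.2⟩, hu⟩
  · exact intervalIntegrable_const
  · refine Filter.Eventually.of_forall fun s _ u _ => ?_
    have h1 : HasDerivAt (fun u : ℝ => x + s * (u - x)) s u := by
      simpa using (((hasDerivAt_id u).sub_const x).const_mul s).const_add x
    have h2 := ((hF.hasDerivAt_iteratedDeriv (n + 1) (x + s * (u - x))).scomp u h1).const_smul (s ^ n)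
    rw [smul_smul, ← pow_succ] at h2
    exact h2

/-- Hadamard's lemma, with bounds for the derivatives of the quotient. -/
theorem exists_hadamard_quotient {F : ℝ → 𝕜} (hF : ContDiff ℝ ∞ F) (x : ℝ) :
    ∃ g : ℝ → 𝕜, ContDiff ℝ ∞ g ∧ (∀ t, F t = F x + ((t : 𝕜) - x) * g t) ∧
      ∀ Ω : Set ℝ, Convex ℝ Ω → x ∈ Ω → ∀ (j : ℕ) (B : ℝ),
        (∀ t ∈ Ω, ‖iteratedDeriv (j + 1) F t‖ ≤ B) → ∀ t ∈ Ω, ‖iteratedDeriv j g t‖ ≤ B := by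
  obtain ⟨h1, h2⟩ := contDiff_of_hasDerivAt_succ (hasDerivAt_hadamardDeriv hF x)
  refine ⟨_, h1, fun t => ?_, fun Ω hΩ hx j B hB t ht => ?_⟩
  · have hd : ∀ s ∈ uIcc (0 : ℝ) 1, HasDerivAt (fun s : ℝ => F (x + s * (t - x)))
        ((t - x) • iteratedDeriv 1 F (x + s * (t - x))) s := by
      intro s _
      have h1 : HasDerivAt (fun s : ℝ => x + s * (t - x)) (t - x) s := by
        simpa using ((hasDerivAt_id s).mul_const (t - x)).const_add x
      have h0 := hF.hasDerivAt_iteratedDeriv 0 (x + s * (t - x))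
      rw [iteratedDeriv_zero] at h0
      exact h0.scomp s h1
    have hint := intervalIntegral.integral_eq_sub_of_hasDerivAt hd
      (Continuous.intervalIntegrable (by
        exact continuous_const.smul ((hF.continuous_iteratedDeriv_infty 1).comp (by fun_prop))) _ _)
    rw [intervalIntegral.integral_smul] at hint
    simp only [hadamardDeriv, pow_zero, one_smul, zero_add]
    simp only [one_mul, zero_mul, add_zero, add_sub_cancel] at hint
    rw [RCLike.real_smul_eq_coe_mul] at hint
    push_cast at hint
    rw [hint]; ring
  · rw [h2 j]
    have := intervalIntegral.norm_integral_le_of_norm_le_const (a := 0) (b := 1) (C := B)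
      (f := fun s : ℝ => s ^ j • iteratedDeriv (j + 1) F (x + s * (t - x))) (fun s hs => ?_)
    · simpa [hadamardDeriv] using this
    · rw [uIoc_of_le zero_le_one] at hs
      -- The quotient averages a derivative of `F` over the segment from x to t, so bounds on a
      -- convex set pass to it without loss.
      have hm : x + s * (t - x) ∈ Ω := by
        have := hΩ hx ht (sub_nonneg.2 hs.2) hs.1.le (by ring)
        simp only [smul_eq_mul] at this
        convert this using 1; ring
      have h3 := hB _ hm
      rw [norm_smul, norm_pow, Real.norm_of_nonneg hs.1.le]
      calc s ^ j * _ ≤ 1 * ‖iteratedDeriv (j + 1) F (x + s * (t - x))‖ := by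
            gcongr; exact pow_le_one₀ hs.1.le hs.2
        _ ≤ B := by simpa using h3

end Hadamard

/-! ### Leibniz estimates and derivatives of polynomials. -/

section Leibniz

variable {𝕜 : Type*} [RCLike 𝕜]

theorem norm_iteratedDeriv_mul_le {f g : ℝ → 𝕜} (hf : ContDiff ℝ ∞ f) (hg : ContDiff ℝ ∞ g)
    {j : ℕ} {t A B : ℝ} (hA : ∀ a ≤ j, ‖iteratedDeriv a f t‖ ≤ A)
    (hB : ∀ b ≤ j, ‖iteratedDeriv b g t‖ ≤ B) :
    ‖iteratedDeriv j (fun u => f u * g u) t‖ ≤ 2 ^ j * (A * B) := by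
  have h := iteratedDeriv_mul (n := j) (x := t) (hf.contDiffAt.of_le (by exact_mod_cast le_top))
    (hg.contDiffAt.of_le (by exact_mod_cast le_top))
  change iteratedDeriv j (fun u => f u * g u) t = _ at h
  rw [h]
  refine (norm_sum_le _ _).trans ?_
  have : (2 : ℝ) ^ j * (A * B) = ∑ i ∈ Finset.range (j + 1), (j.choose i : ℝ) * (A * B) := by
    rw [← Finset.sum_mul]; congr 1; exact_mod_cast (Nat.sum_range_choose j).symm
  rw [this]
  refine Finset.sum_le_sum fun i hi => ?_
  have hi' : i ≤ j := Nat.lt_succ_iff.1 (Finset.mem_range.1 hi)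
  rw [norm_mul, norm_mul, RCLike.norm_natCast, mul_assoc]
  have := hA i hi'
  have := hB (j - i) (Nat.sub_le _ _)
  have : 0 ≤ A := (norm_nonneg _).trans (hA i hi')
  gcongr

theorem iteratedDeriv_mul_eq_zero {f g : ℝ → 𝕜} (hf : ContDiff ℝ ∞ f) (hg : ContDiff ℝ ∞ g)
    {j : ℕ} {t : ℝ} (h0 : ∀ a ≤ j, iteratedDeriv a f t = 0) :
    iteratedDeriv j (fun u => f u * g u) t = 0 := by
  have h := iteratedDeriv_mul (n := j) (x := t) (hf.contDiffAt.of_le (by exact_mod_cast le_top))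
    (hg.contDiffAt.of_le (by exact_mod_cast le_top))
  change iteratedDeriv j (fun u => f u * g u) t = _ at h
  rw [h]
  refine Finset.sum_eq_zero fun i hi => ?_
  rw [h0 i (Nat.lt_succ_iff.1 (Finset.mem_range.1 hi))]; simp

theorem contDiff_ofReal : ContDiff ℝ ∞ fun t : ℝ => (t : 𝕜) :=
  (RCLike.ofRealCLM (K := 𝕜)).contDiff

theorem contDiff_eval (P : 𝕜[X]) : ContDiff ℝ ∞ fun t : ℝ => P.eval (t : 𝕜) := by
  have h : ContDiff ℝ ∞ fun z : 𝕜 => P.eval z :=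
    (P.contDiff_aeval (𝕜 := 𝕜) ∞ |>.restrict_scalars ℝ : _)
  exact h.comp contDiff_ofReal

theorem iteratedDeriv_eval (P : 𝕜[X]) (j : ℕ) (t : ℝ) :
    iteratedDeriv j (fun t : ℝ => P.eval (t : 𝕜)) t = (derivative^[j] P).eval (t : 𝕜) := by
  have := (contDiff_of_hasDerivAt_succ (G := fun j (t : ℝ) => (derivative^[j] P).eval (t : 𝕜))
    (fun n t => ?_)).2 j
  · exact congrFun this t
  · rw [Function.iterate_succ_apply']
    have := ((derivative^[n] P).hasDerivAt (t : 𝕜)).scomp t (RCLike.ofRealCLM (K := 𝕜)).hasDerivAt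
    simp only [RCLike.ofRealCLM_apply, RCLike.ofReal_one, one_smul] at this
    exact this

theorem contDiff_sub_pow (x : ℝ) (p : ℕ) : ContDiff ℝ ∞ fun t : ℝ => ((t : 𝕜) - x) ^ p :=
  (contDiff_ofReal.sub contDiff_const).pow p

theorem iteratedDeriv_sub_pow (x : ℝ) (p j : ℕ) (t : ℝ) :
    iteratedDeriv j (fun t : ℝ => ((t : 𝕜) - x) ^ p) t =
      p.descFactorial j * ((t : 𝕜) - x) ^ (p - j) := by
  have := iteratedDeriv_eval ((X - C (x : 𝕜)) ^ p) j t
  simp only [eval_pow, eval_sub, eval_X, eval_C] at this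
  rw [this, iterate_derivative_X_sub_pow]
  simp

theorem iteratedDeriv_sub_pow_mul_eq_zero {g : ℝ → 𝕜} (hg : ContDiff ℝ ∞ g) (x : ℝ) {p j : ℕ}
    (hj : j < p) : iteratedDeriv j (fun t : ℝ => ((t : 𝕜) - x) ^ p * g t) x = 0 := by
  refine iteratedDeriv_mul_eq_zero (contDiff_sub_pow x p) hg fun a ha => ?_
  rw [iteratedDeriv_sub_pow, sub_self, zero_pow (by omega), mul_zero]

end Leibniz

/-! ### Hermite interpolation and Taylor expansion. -/

section Hermite

variable {𝕜 : Type*} [RCLike 𝕜]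

theorem iterate_derivative_X_sub_C_mul_succ (a : 𝕜) (P : 𝕜[X]) (b : ℕ) :
    derivative^[b + 1] ((X - C a) * P) =
      (X - C a) * derivative^[b + 1] P + (b + 1 : 𝕜[X]) * derivative^[b] P := by
  induction b with
  | zero => simp; ring
  | succ b ih =>
    rw [Function.iterate_succ_apply', ih, derivative_add, derivative_mul, derivative_mul,
      ← Function.iterate_succ_apply' derivative (b + 1), ← Function.iterate_succ_apply' derivative b]
    simp; ring

/-- Hermite interpolation at the multiset of nodes `M`: the interpolating polynomial is bounded by
the derivatives of order `< card M`, and the remainder by the one of order `card M`. -/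
theorem exists_hermite_interpolation (M : Multiset ℝ) {F : ℝ → 𝕜} (hF : ContDiff ℝ ∞ F) :
    ∃ (P : 𝕜[X]) (g : ℝ → 𝕜), ContDiff ℝ ∞ g ∧ P.natDegree ≤ M.card ∧
      (∀ t : ℝ, F t = P.eval (t : 𝕜) + (M.map fun x : ℝ => (t : 𝕜) - x).prod * g t) ∧
      (∀ Ω : Set ℝ, Convex ℝ Ω → (∀ x ∈ M, x ∈ Ω) → ∀ B : ℝ,
        (∀ t ∈ Ω, ‖iteratedDeriv M.card F t‖ ≤ B) → ∀ t ∈ Ω, ‖g t‖ ≤ B) ∧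
      (∀ Ω : Set ℝ, Convex ℝ Ω → (∀ x ∈ M, x ∈ Ω) → ∀ B : ℝ, 0 ≤ B →
        (∀ j < M.card, ∀ t ∈ Ω, ‖iteratedDeriv j F t‖ ≤ B) →
        ∀ R : ℝ, 0 ≤ R → (∀ x ∈ M, |x| ≤ R) → ∀ m b : ℕ, b ≤ m → ∀ t : ℝ, |t| ≤ R →
          ‖(derivative^[b] P).eval (t : 𝕜)‖ ≤ (2 * R + m + 1) ^ M.card * B) := by
  induction M using Multiset.induction generalizing F with
  | empty =>
    refine ⟨0, F, hF, by simp, by simp, fun Ω _ _ B h t ht => by simpa using h t ht, ?_⟩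
    intro Ω _ _ B hB _ R _ _ m b _ t _
    simpa using hB
  | cons x M ih =>
    obtain ⟨F₁, hF₁, hFx, hb⟩ := exists_hadamard_quotient hF x
    obtain ⟨P, g, hg, hdeg, hP, hgB, hPB⟩ := ih hF₁
    refine ⟨C (F x) + (X - C (x : 𝕜)) * P, g, hg, ?_, fun t => ?_, ?_, ?_⟩
    · refine (natDegree_add_le _ _).trans (max_le (by simp) ?_)
      refine natDegree_mul_le.trans ?_
      rw [natDegree_X_sub_C, Multiset.card_cons]; omega
    · rw [hFx t, hP t]
      simp only [eval_add, eval_C, eval_mul, eval_sub, eval_X, Multiset.map_cons,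
        Multiset.prod_cons]
      ring
    · intro Ω hΩ hM B hB t ht
      rw [Multiset.card_cons] at hB
      exact hgB Ω hΩ (fun y hy => hM y (Multiset.mem_cons_of_mem hy)) B
        (hb Ω hΩ (hM x (Multiset.mem_cons_self x M)) _ B hB) t ht
    · intro Ω hΩ hM B hB hFB R hR hMR m b hbm t ht
      have hx := hM x (Multiset.mem_cons_self x M)
      have hxR := hMR x (Multiset.mem_cons_self x M)
      rw [Multiset.card_cons] at hFB ⊢
      have hP1 := hPB Ω hΩ (fun y hy => hM y (Multiset.mem_cons_of_mem hy)) B hB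
        (fun j hj => hb Ω hΩ hx j B (hFB (j + 1) (by omega))) R hR
        (fun y hy => hMR y (Multiset.mem_cons_of_mem hy)) m
      have hFx0 : ‖F x‖ ≤ B := by simpa using hFB 0 (by omega) x hx
      set D : ℝ := 2 * R + m + 1 with hD
      have hD1 : 1 ≤ D := by rw [hD]; have : (0 : ℝ) ≤ m := m.cast_nonneg; linarith
      set W : ℝ := D ^ M.card * B with hW
      have hBW : B ≤ W := le_mul_of_one_le_left hB (one_le_pow₀ hD1)
      have hW0 : 0 ≤ W := hB.trans hBW
      have htx : ‖(t : 𝕜) - x‖ ≤ 2 * R := by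
        rw [← RCLike.ofReal_sub, RCLike.norm_ofReal]
        exact (abs_sub t x).trans (by linarith)
      -- One node costs a factor D = 1 + 2R + m: 1 for the constant `F x`, 2R for the factor t - x,
      -- and m for the Leibniz term in which t - x is differentiated.
      have goal : D ^ (M.card + 1) * B = W + 2 * R * W + m * W := by
        rw [hW, pow_succ, hD]; ring
      rw [goal]
      have h0 := hP1 b hbm t ht
      have hm0 : (0 : ℝ) ≤ m := m.cast_nonneg
      rcases b with _ | b
      · simp only [Function.iterate_zero, id, eval_add, eval_C, eval_mul, eval_sub, eval_X] at h0 ⊢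
        refine (norm_add_le _ _).trans ?_
        rw [norm_mul]
        have : ‖(t : 𝕜) - x‖ * ‖eval (t : 𝕜) P‖ ≤ 2 * R * W := by gcongr
        have : 0 ≤ m * W := by positivity
        linarith
      · have h1 := hP1 b (by omega) t ht
        rw [iterate_map_add, iterate_derivative_C (Nat.succ_pos b), zero_add,
          iterate_derivative_X_sub_C_mul_succ]
        simp only [eval_add, eval_C, eval_mul, eval_sub, eval_X, eval_natCast, eval_one]
        refine (norm_add_le _ _).trans ?_
        rw [norm_mul, norm_mul]
        have h2 : ‖(t : 𝕜) - x‖ * ‖eval (t : 𝕜) (derivative^[b + 1] P)‖ ≤ 2 * R * W := by gcongr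
        have h3 : ‖(b : 𝕜) + 1‖ ≤ m := by
          have : (b : 𝕜) + 1 = ((b + 1 : ℕ) : 𝕜) := by push_cast; ring
          rw [this, RCLike.norm_natCast]; exact_mod_cast hbm
        have h4 : ‖(b : 𝕜) + 1‖ * ‖eval (t : 𝕜) (derivative^[b] P)‖ ≤ m * W := by gcongr
        linarith

/-- Taylor's formula with a smooth remainder. -/
theorem exists_taylor {F : ℝ → 𝕜} (hF : ContDiff ℝ ∞ F) (y : ℝ) (N : ℕ) :
    ∃ (P : 𝕜[X]) (g : ℝ → 𝕜), ContDiff ℝ ∞ g ∧ P.natDegree ≤ N ∧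
      (∀ t : ℝ, F t = P.eval (t : 𝕜) + ((t : 𝕜) - y) ^ N * g t) ∧
      (∀ j < N, (derivative^[j] P).eval (y : 𝕜) = iteratedDeriv j F y) ∧
      (∀ Ω : Set ℝ, Convex ℝ Ω → y ∈ Ω → ∀ B : ℝ,
        (∀ t ∈ Ω, ‖iteratedDeriv N F t‖ ≤ B) → ∀ t ∈ Ω, ‖g t‖ ≤ B) ∧
      (∀ B : ℝ, 0 ≤ B → (∀ j < N, ‖iteratedDeriv j F y‖ ≤ B) →
        ∀ R : ℝ, 0 ≤ R → |y| ≤ R → ∀ t : ℝ, |t| ≤ R →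
          ‖P.eval (t : 𝕜)‖ ≤ (2 * R + 1) ^ N * B) := by
  obtain ⟨P, g, hg, hdeg, hP, hgB, hPB⟩ := exists_hermite_interpolation (Multiset.replicate N y) hF
  simp only [Multiset.card_replicate, Multiset.map_replicate, Multiset.prod_replicate] at *
  have hmem : ∀ x ∈ Multiset.replicate N y, x = y := fun x hx => Multiset.eq_of_mem_replicate hx
  refine ⟨P, g, hg, hdeg, hP, fun j hj => ?_, fun Ω hΩ hy => hgB Ω hΩ ?_, ?_⟩
  · have h1 := iteratedDeriv_sub_pow_mul_eq_zero hg y hj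
    have h2 : F = (fun t : ℝ => P.eval (t : 𝕜)) + fun t : ℝ => ((t : 𝕜) - y) ^ N * g t := funext hP
    rw [← iteratedDeriv_eval]
    conv_rhs => rw [h2]
    rw [iteratedDeriv_add ((contDiff_eval P).contDiffAt.of_le (by exact_mod_cast le_top))
      (((contDiff_sub_pow y N).mul hg).contDiffAt.of_le (by exact_mod_cast le_top)), h1, add_zero]
  · rintro x hx; rwa [hmem x hx]
  · intro B hB hFB R hR hyR t ht
    -- All nodes coincide, so the convex set may be the single point y, and only derivatives at y
    -- enter.
    have := hPB {y} (convex_singleton y) (fun x hx => hmem x hx) B hB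
      (fun j hj t ht => by rw [mem_singleton_iff.1 ht]; exact hFB j hj) R hR
      (fun x hx => by rwa [hmem x hx]) 0 0 le_rfl t ht
    simpa using this

/-- A smooth function vanishing at `y` to order `N` is divisible by `(t - y) ^ N`. -/
theorem exists_eq_sub_pow_mul {F : ℝ → 𝕜} (hF : ContDiff ℝ ∞ F) (y : ℝ) (N : ℕ)
    (h : ∀ j < N, iteratedDeriv j F y = 0) :
    ∃ g : ℝ → 𝕜, ContDiff ℝ ∞ g ∧ (∀ t : ℝ, F t = ((t : 𝕜) - y) ^ N * g t) ∧
      (∀ Ω : Set ℝ, Convex ℝ Ω → y ∈ Ω → ∀ B : ℝ,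
        (∀ t ∈ Ω, ‖iteratedDeriv N F t‖ ≤ B) → ∀ t ∈ Ω, ‖g t‖ ≤ B) := by
  obtain ⟨P, g, hg, -, hP, -, hgB, hPB⟩ := exists_taylor hF y N
  refine ⟨g, hg, fun t => ?_, hgB⟩
  -- The bound B = 0 forces the Taylor polynomial to vanish at t.
  have h0 := hPB 0 le_rfl (fun j hj => by rw [h j hj]; simp) (max |y| |t|) (by positivity)
    (le_max_left _ _) t (le_max_right _ _)
  rw [mul_zero, norm_le_zero_iff] at h0
  rw [hP t, h0, zero_add]

end Hermite

/-! ### Partitions of unity on small scales. -/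

section Cutoff

variable {𝕜 : Type*} [RCLike 𝕜]

/-- A smooth function supported in `[0, 2]` whose integer translates sum up to `1`. -/
noncomputable def unitCutoff (𝕜 : Type*) [RCLike 𝕜] (t : ℝ) : 𝕜 :=
  ((Real.smoothTransition t - Real.smoothTransition (t - 1) : ℝ) : 𝕜)

/-- The rescaled cutoff function, supported in `[u δ, (u + 2) δ]`. -/
noncomputable def cellCutoff (𝕜 : Type*) [RCLike 𝕜] (δ u t : ℝ) : 𝕜 := unitCutoff 𝕜 (δ⁻¹ * t - u)

theorem contDiff_unitCutoff : ContDiff ℝ ∞ (unitCutoff 𝕜) :=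
  contDiff_ofReal.comp (Real.smoothTransition.contDiff.sub
    (Real.smoothTransition.contDiff.comp (contDiff_id.sub contDiff_const)))

theorem contDiff_cellCutoff (δ u : ℝ) : ContDiff ℝ ∞ (cellCutoff 𝕜 δ u) :=
  contDiff_unitCutoff.comp ((contDiff_const.mul contDiff_id).sub contDiff_const)

theorem unitCutoff_eq_zero {t : ℝ} (ht : t ∉ Icc (0 : ℝ) 2) : unitCutoff 𝕜 t = 0 := by
  rw [mem_Icc, not_and_or, not_le, not_le] at ht
  rw [unitCutoff]
  rcases ht with h | h
  · rw [Real.smoothTransition.zero_of_nonpos h.le,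
      Real.smoothTransition.zero_of_nonpos (by linarith)]; simp
  · rw [Real.smoothTransition.one_of_one_le (by linarith),
      Real.smoothTransition.one_of_one_le (by linarith)]; simp

theorem eventually_unitCutoff_eq_zero {t : ℝ} (ht : t ∉ Icc (0 : ℝ) 2) :
    unitCutoff 𝕜 =ᶠ[𝓝 t] fun _ => 0 := by
  filter_upwards [isClosed_Icc.isOpen_compl.mem_nhds ht] with s hs using unitCutoff_eq_zero hs

theorem eventually_cellCutoff_eq_zero {δ u t : ℝ} (hδ : 0 < δ)
    (ht : t ∉ Icc (u * δ) ((u + 2) * δ)) : cellCutoff 𝕜 δ u =ᶠ[𝓝 t] fun _ => 0 := by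
  filter_upwards [isClosed_Icc.isOpen_compl.mem_nhds ht] with s hs
  refine unitCutoff_eq_zero fun h => hs ⟨?_, ?_⟩
  · have := h.1
    rw [sub_nonneg, inv_mul_eq_div, le_div_iff₀ hδ] at this; exact this
  · have := h.2
    rw [sub_le_iff_le_add', inv_mul_eq_div, div_le_iff₀ hδ] at this; exact this

theorem exists_norm_iteratedDeriv_unitCutoff_le (𝕜 : Type*) [RCLike 𝕜] (m : ℕ) :
    ∃ A : ℝ, 0 < A ∧ ∀ a ≤ m, ∀ t, ‖iteratedDeriv a (unitCutoff 𝕜) t‖ ≤ A := by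
  have h : ∀ a : ℕ, ∃ A : ℝ, 0 < A ∧ ∀ t, ‖iteratedDeriv a (unitCutoff 𝕜) t‖ ≤ A := by
    intro a
    obtain ⟨A, hA⟩ := (isCompact_Icc (a := (0 : ℝ)) (b := 2)).exists_bound_of_continuousOn
      ((contDiff_unitCutoff (𝕜 := 𝕜)).continuous_iteratedDeriv_infty a).continuousOn
    refine ⟨max A 1, by positivity, fun t => ?_⟩
    by_cases ht : t ∈ Icc (0 : ℝ) 2
    · exact (hA t ht).trans (le_max_left _ _)
    · rw [(eventually_unitCutoff_eq_zero ht).iteratedDeriv_eq a, iteratedDeriv_fun_const_zero]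
      simp
  choose A hA0 hA using h
  refine ⟨∑ a ∈ Finset.range (m + 1), A a, Finset.sum_pos (fun a _ => hA0 a) (by simp),
    fun a ha t => (hA a t).trans ?_⟩
  exact Finset.single_le_sum (f := A) (fun a _ => (hA0 a).le) (Finset.mem_range.2 (by omega))

theorem iteratedDeriv_cellCutoff (δ u : ℝ) (a : ℕ) (t : ℝ) :
    iteratedDeriv a (cellCutoff 𝕜 δ u) t =
      (δ⁻¹) ^ a • iteratedDeriv a (unitCutoff 𝕜) (δ⁻¹ * t - u) := by
  have h := iteratedDeriv_comp_const_smul (n := a) (f := fun s => unitCutoff 𝕜 (s - u))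
    ((contDiff_unitCutoff.comp (contDiff_id.sub contDiff_const)).of_le
      (by exact_mod_cast le_top)) δ⁻¹
  have h2 := congrFun h t
  rw [iteratedDeriv_comp_sub_const] at h2
  exact h2

/-- Each cutoff is a difference of consecutive translates of one transition function, so the sum
telescopes. -/
theorem sum_cellCutoff (δ : ℝ) (M : ℕ) (t : ℝ) :
    ∑ k ∈ Finset.range (2 * M), cellCutoff 𝕜 δ ((k : ℝ) - M) t =
      ((Real.smoothTransition (δ⁻¹ * t + M) - Real.smoothTransition (δ⁻¹ * t - M) : ℝ) : 𝕜) := by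
  have h := Finset.sum_range_sub' (fun k : ℕ => Real.smoothTransition (δ⁻¹ * t + M - k)) (2 * M)
  simp only [cellCutoff, unitCutoff]
  rw [← RCLike.ofReal_sum]
  congr 1
  convert h using 2 with k
  · congr 2
    · ring
    · push_cast; ring
  · simp
  · push_cast; ring_nf

/-- Partitions of unity on the scale `δ`, and bounds for functions glued with them. -/
theorem exists_partition (𝕜 : Type*) [RCLike 𝕜] (m : ℕ) {R : ℝ} (hR : 0 ≤ R) :
    ∃ A : ℝ, 0 < A ∧ ∀ δ : ℝ, 0 < δ → δ ≤ 1 → ∃ (N : ℕ) (u : ℕ → ℝ),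
      (∀ t : ℝ, |t| ≤ R → ∑ k ∈ Finset.range N, cellCutoff 𝕜 δ (u k) t = 1) ∧
      ∀ H : ℕ → ℝ → 𝕜, (∀ k, ContDiff ℝ ∞ (H k)) → ∀ B : ℝ, 0 ≤ B →
        (∀ k, ∀ b ≤ m, ∀ t ∈ Icc (u k * δ) ((u k + 2) * δ), |t| ≤ R →
          ‖iteratedDeriv b (H k) t‖ ≤ B) →
        ∀ j ≤ m, ∀ t, |t| ≤ R → ‖iteratedDeriv j
          (fun t => ∑ k ∈ Finset.range N, cellCutoff 𝕜 δ (u k) t * H k t) t‖ ≤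
            A * (δ ^ (m + 1))⁻¹ * B := by
  obtain ⟨A, hA0, hA⟩ := exists_norm_iteratedDeriv_unitCutoff_le 𝕜 m
  refine ⟨(2 * R + 4) * (2 ^ m * A), by positivity, fun δ hδ hδ1 => ?_⟩
  obtain ⟨hM1, hM2⟩ : R / δ ≤ ⌈R / δ⌉₊ ∧ (⌈R / δ⌉₊ : ℝ) < R / δ + 1 :=
    ⟨Nat.le_ceil _, Nat.ceil_lt_add_one (by positivity)⟩
  -- The extra 1 makes the first transition function of the telescoped sum equal to 1 on all of [-R,
  -- R].
  set M : ℕ := ⌈R / δ⌉₊ + 1 with hM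
  have hMr : (M : ℝ) = ⌈R / δ⌉₊ + 1 := by rw [hM]; push_cast; ring
  refine ⟨2 * M, fun k => (k : ℝ) - M, fun t ht => ?_, fun H hH B hB hHB j hj t htR => ?_⟩
  · have h1 : |δ⁻¹ * t| ≤ R / δ := by
      rw [abs_mul, abs_of_pos (inv_pos.2 hδ), inv_mul_eq_div]; gcongr
    rw [abs_le] at h1
    rw [sum_cellCutoff, Real.smoothTransition.one_of_one_le (by linarith),
      Real.smoothTransition.zero_of_nonpos (by linarith)]
    simp
  · rw [iteratedDeriv_fun_sum fun k _ => ((contDiff_cellCutoff δ _).mul (hH k)).contDiffAt.of_le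
      (by exact_mod_cast le_top)]
    refine (norm_sum_le _ _).trans ?_
    have hδi : 1 ≤ δ⁻¹ := (one_le_inv₀ hδ).2 hδ1
    have hterm : ∀ k ∈ Finset.range (2 * M), ‖iteratedDeriv j
        (fun t => cellCutoff 𝕜 δ ((k : ℝ) - M) t * H k t) t‖ ≤ 2 ^ m * ((δ⁻¹ ^ m * A) * B) := by
      intro k _
      by_cases ht : t ∈ Icc (((k : ℝ) - M) * δ) (((k : ℝ) - M + 2) * δ)
      · refine (norm_iteratedDeriv_mul_le (contDiff_cellCutoff δ _) (hH k)
          (A := δ⁻¹ ^ m * A) (B := B) (fun a ha => ?_)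
          (fun b hb => hHB k b (hb.trans hj) t ht htR)).trans ?_
        · rw [iteratedDeriv_cellCutoff, norm_smul, norm_pow, Real.norm_of_nonneg (by positivity)]
          gcongr
          · exact ha.trans hj
          · exact hA a (ha.trans hj) _
        · gcongr
          exact one_le_two
      · have : (fun t => cellCutoff 𝕜 δ ((k : ℝ) - M) t * H k t) =ᶠ[𝓝 t] fun _ => 0 := by
          filter_upwards [eventually_cellCutoff_eq_zero (𝕜 := 𝕜) hδ ht] with s hs
          rw [hs, zero_mul]
        rw [this.iteratedDeriv_eq, iteratedDeriv_fun_const_zero, norm_zero]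
        positivity
    refine (Finset.sum_le_card_nsmul _ _ _ hterm).trans ?_
    rw [Finset.card_range, nsmul_eq_mul]
    -- All cells are counted, not only those meeting t. This costs one factor 1/δ, on top of the
    -- δ^(-m) from differentiating the cutoffs.
    have hcount : ((2 * M : ℕ) : ℝ) ≤ (2 * R + 4) * δ⁻¹ := by
      push_cast
      rw [hMr, add_mul, mul_assoc 2 R, ← div_eq_mul_inv R]
      linarith
    calc ((2 * M : ℕ) : ℝ) * (2 ^ m * ((δ⁻¹ ^ m * A) * B))
        ≤ ((2 * R + 4) * δ⁻¹) * (2 ^ m * ((δ⁻¹ ^ m * A) * B)) := by gcongr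
      _ = _ := by rw [pow_succ, mul_inv, inv_pow]; ring

end Cutoff

/-! ### Spectral synthesis for closed ideals. -/

section ClosedIdeal

variable {𝕜 : Type*} [RCLike 𝕜]

theorem contDiff_coe (f : smoothFunctions 𝕜) : ContDiff ℝ ∞ (f : ℝ → 𝕜) := f.2

theorem iteratedDeriv_coe_sub (f g : smoothFunctions 𝕜) (j : ℕ) (t : ℝ) :
    iteratedDeriv j ((f - g : smoothFunctions 𝕜) : ℝ → 𝕜) t =
      iteratedDeriv j (f : ℝ → 𝕜) t - iteratedDeriv j (g : ℝ → 𝕜) t :=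
  iteratedDeriv_sub ((contDiff_coe f).contDiffAt.of_le (by exact_mod_cast le_top))
    ((contDiff_coe g).contDiffAt.of_le (by exact_mod_cast le_top))

/-- A function that can be approximated by elements of a closed ideal, uniformly on all intervals
`[-m, m]` together with the derivatives of order at most `m`, belongs to the ideal. -/
theorem mem_of_forall_exists_approx {I : Ideal (smoothFunctions 𝕜)}
    (hI : IsClosed[smoothTopology 𝕜] (I : Set (smoothFunctions 𝕜))) (g : smoothFunctions 𝕜)
    (h : ∀ (m : ℕ) (η : ℝ), 0 < η → ∃ f ∈ I, ∀ j ≤ m, ∀ t ∈ Icc (-(m : ℝ)) m,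
      ‖iteratedDeriv j ((g - f : smoothFunctions 𝕜) : ℝ → 𝕜) t‖ ≤ η) : g ∈ I := by
  choose f hfI hf using fun m : ℕ => h m (1 / ((m : ℝ) + 1)) (by positivity)
  let _ := smoothTopology 𝕜
  refine IsClosed.mem_of_tendsto (b := Filter.atTop) (f := f) hI ?_
    (Filter.Eventually.of_forall hfI)
  rw [nhds_induced, Filter.tendsto_comap_iff, tendsto_pi_nhds]
  intro j
  rw [ContinuousMap.tendsto_iff_forall_isCompact_tendstoUniformlyOn]
  intro K hK
  obtain ⟨R, hR⟩ := hK.isBounded.subset_closedBall 0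
  rw [Metric.tendstoUniformlyOn_iff]
  intro η hη
  have h1 := (tendsto_one_div_add_atTop_nhds_zero_nat (𝕜 := ℝ)).eventually (gt_mem_nhds hη)
  filter_upwards [h1, Filter.eventually_ge_atTop j, Filter.eventually_ge_atTop ⌈R⌉₊] with m hm hjm hRm
  intro t ht
  have htR : |t| ≤ m := by
    have := hR ht
    rw [Metric.mem_closedBall, dist_zero_right, Real.norm_eq_abs] at this
    exact this.trans ((Nat.le_ceil R).trans (by exact_mod_cast hRm))
  rw [dist_eq_norm]
  have := hf m j hjm t (abs_le.1 htR)
  rw [iteratedDeriv_coe_sub] at this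
  exact this.trans_lt hm

theorem iteratedDeriv_eq_zero_of_mem {I : Ideal (smoothFunctions 𝕜)} {f : smoothFunctions 𝕜}
    (hf : f ∈ I) {x : ℝ} {j : ℕ} (hj : (j : ℕ∞) < zeroMultiplicity I x) :
    iteratedDeriv j (f : ℝ → 𝕜) x = 0 := by
  obtain ⟨p, hp, hjp⟩ := lt_sSup_iff.1 hj
  exact hp f hf j hjp

theorem exists_mem_iteratedDeriv_ne_zero {I : Ideal (smoothFunctions 𝕜)} {x : ℝ} {p : ℕ}
    (hp : zeroMultiplicity I x = p) : ∃ f ∈ I, iteratedDeriv p (f : ℝ → 𝕜) x ≠ 0 := by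
  by_contra! hne
  have : ((p + 1 : ℕ) : ℕ∞) ≤ zeroMultiplicity I x := by
    refine le_sSup fun f hf j hj => ?_
    rcases Nat.lt_succ_iff_lt_or_eq.1 (Nat.cast_lt.1 hj) with h | rfl
    · exact iteratedDeriv_eq_zero_of_mem hf (by rw [hp]; exact_mod_cast h)
    · exact hne f hf
  rw [hp] at this
  exact absurd (Nat.cast_le.1 this) (by omega)

/-- `g` has at every point a zero of at least the multiplicity prescribed by `I`. -/
def VanishesLike (I : Ideal (smoothFunctions 𝕜)) (g : ℝ → 𝕜) : Prop :=
  ∀ (x : ℝ) (j : ℕ), (j : ℕ∞) < zeroMultiplicity I x → iteratedDeriv j g x = 0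

/-- If the multiplicity p at x is finite, some h in the ideal vanishes there to order exactly p.
Then g/h extends smoothly near x, and χg is a smooth multiple of h. -/
theorem exists_cutoff_mul_mem {I : Ideal (smoothFunctions 𝕜)} {g : smoothFunctions 𝕜}
    (hg : VanishesLike I (g : ℝ → 𝕜)) {x : ℝ} (hx : zeroMultiplicity I x ≠ ⊤) :
    ∃ χ : smoothFunctions 𝕜, (∀ᶠ t in 𝓝 x, (χ : ℝ → 𝕜) t = 1) ∧ χ * g ∈ I := by
  obtain ⟨p, hp⟩ := ENat.ne_top_iff_exists.1 hx
  obtain ⟨h, hhI, hhp⟩ := exists_mem_iteratedDeriv_ne_zero hp.symm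
  obtain ⟨v, hv, hgv, -⟩ := exists_eq_sub_pow_mul (contDiff_coe g) x p
    (fun j hj => hg x j (by rw [← hp]; exact_mod_cast hj))
  obtain ⟨w, hw, hhw, -⟩ := exists_eq_sub_pow_mul (contDiff_coe h) x p
    (fun j hj => iteratedDeriv_eq_zero_of_mem hhI (by rw [← hp]; exact_mod_cast hj))
  -- Otherwise a further factor t - x could be split off, and the derivative of h of order p would
  -- vanish.
  have hwx : w x ≠ 0 := by
    intro h0
    obtain ⟨w', hw', hww', -⟩ := exists_hadamard_quotient hw x
    refine hhp ?_
    have : (h : ℝ → 𝕜) = fun t : ℝ => ((t : 𝕜) - x) ^ (p + 1) * w' t := by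
      funext t; rw [hhw t, hww' t, h0]; ring
    rw [this]
    exact iteratedDeriv_sub_pow_mul_eq_zero hw' x (Nat.lt_succ_self p)
  obtain ⟨ρ, hρ, hball⟩ := Metric.mem_nhds_iff.1 (hw.continuous.continuousAt.eventually_ne hwx)
  let b : ContDiffBump x := ⟨ρ / 4, ρ / 2, by positivity, by linarith⟩
  have hb0 : ∀ t, w t = 0 → (fun t => ((b t : ℝ) : 𝕜)) =ᶠ[𝓝 t] fun _ => 0 := by
    intro t ht
    have : t ∉ tsupport b := by
      rw [b.tsupport_eq]
      intro htb
      exact hball (Metric.closedBall_subset_ball (by change ρ / 2 < ρ; linarith) htb) ht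
    filter_upwards [(isClosed_tsupport b).isOpen_compl.mem_nhds this] with s hs
    rw [image_eq_zero_of_notMem_tsupport hs, RCLike.ofReal_zero]
  have hbs : ContDiff ℝ ∞ fun t => ((b t : ℝ) : 𝕜) := contDiff_ofReal.comp b.contDiff
  have hq : ContDiff ℝ ∞ fun t => ((b t : ℝ) : 𝕜) * v t / w t := by
    rw [contDiff_iff_contDiffAt]
    intro t
    by_cases ht : w t = 0
    · refine (contDiffAt_const (c := 0)).congr_of_eventuallyEq ?_
      filter_upwards [hb0 t ht] with s hs
      rw [hs, zero_mul, zero_div]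
    · simp only [div_eq_mul_inv]
      exact (hbs.mul hv).contDiffAt.mul (hw.contDiffAt.inv ht)
  refine ⟨⟨_, hbs⟩, ?_, ?_⟩
  · filter_upwards [b.eventuallyEq_one] with t ht
    rw [ht]; simp
  · have : (⟨_, hbs⟩ : smoothFunctions 𝕜) * g = ⟨_, hq⟩ * h := by
      apply Subtype.ext
      funext t
      change ((b t : ℝ) : 𝕜) * (g : ℝ → 𝕜) t = (((b t : ℝ) : 𝕜) * v t / w t) * (h : ℝ → 𝕜) t
      rw [hgv t, hhw t]
      by_cases ht : w t = 0
      · rw [(hb0 t ht).eq_of_nhds]; simp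
      · field_simp
    rw [this]
    exact I.mul_mem_left _ hhI

/-- Local cutoffs combine through 1 - (1 - χ)(1 - χ'), which is 1 wherever χ or χ' is, and
compactness does the rest. -/
theorem exists_cutoff_mul_mem_of_isCompact {I : Ideal (smoothFunctions 𝕜)} {g : smoothFunctions 𝕜}
    (hg : VanishesLike I (g : ℝ → 𝕜)) {s : Set ℝ} (hs : IsCompact s)
    (hfin : ∀ x ∈ s, zeroMultiplicity I x ≠ ⊤) :
    ∃ χ : smoothFunctions 𝕜, (∀ t ∈ s, (χ : ℝ → 𝕜) t = 1) ∧ χ * g ∈ I := by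
  refine hs.induction_on (p := fun s : Set ℝ => ∃ χ : smoothFunctions 𝕜,
    (∀ t ∈ s, (χ : ℝ → 𝕜) t = 1) ∧ χ * g ∈ I) ⟨0, by simp, by simp⟩ ?_ ?_ ?_
  · rintro s t hst ⟨χ, h1, h2⟩
    exact ⟨χ, fun x hx => h1 x (hst hx), h2⟩
  · rintro s t ⟨χ, h1, h2⟩ ⟨χ', h1', h2'⟩
    refine ⟨χ + χ' - χ * χ', fun x hx => ?_, ?_⟩
    · change (χ : ℝ → 𝕜) x + (χ' : ℝ → 𝕜) x - (χ : ℝ → 𝕜) x * (χ' : ℝ → 𝕜) x = 1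
      rcases hx with hx | hx
      · rw [h1 x hx]; ring
      · rw [h1' x hx]; ring
    · rw [sub_mul, add_mul, mul_assoc]
      exact I.sub_mem (I.add_mem h2 h2') (I.mul_mem_left _ h2')
  · intro x hx
    obtain ⟨χ, h1, h2⟩ := exists_cutoff_mul_mem hg (hfin x hx)
    exact ⟨_, mem_nhdsWithin_of_mem_nhds h1, χ, fun t ht => ht, h2⟩

theorem ContDiff.contDiff_iteratedDeriv_infty {F : ℝ → 𝕜} (hF : ContDiff ℝ ∞ F) (b : ℕ) :
    ContDiff ℝ ∞ (iteratedDeriv b F) ∧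
      ∀ j, iteratedDeriv j (iteratedDeriv b F) = iteratedDeriv (b + j) F :=
  contDiff_of_hasDerivAt_succ (G := fun j => iteratedDeriv (b + j) F)
    fun j t => hF.hasDerivAt_iteratedDeriv (b + j) t

theorem exists_norm_iteratedDeriv_le {F : ℝ → 𝕜} (hF : ContDiff ℝ ∞ F) (m : ℕ) (R : ℝ) :
    ∃ B : ℝ, 0 ≤ B ∧ ∀ j ≤ m, ∀ t ∈ Icc (-R) R, ‖iteratedDeriv j F t‖ ≤ B := by
  choose B hB using fun j : ℕ => (isCompact_Icc (a := -R) (b := R)).exists_bound_of_continuousOn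
    (hF.continuous_iteratedDeriv_infty j).continuousOn
  refine ⟨∑ j ∈ Finset.range (m + 1), |B j|, by positivity, fun j hj t ht => ?_⟩
  refine (hB j t ht).trans ((le_abs_self _).trans ?_)
  exact Finset.single_le_sum (f := fun j => |B j|) (fun _ _ => abs_nonneg _)
    (Finset.mem_range.2 (by omega))

/-- The element of `C^∞(ℝ)` given by a cutoff function. -/
noncomputable def smoothCell (𝕜 : Type*) [RCLike 𝕜] (δ u : ℝ) : smoothFunctions 𝕜 :=
  ⟨cellCutoff 𝕜 δ u, contDiff_cellCutoff δ u⟩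

theorem coe_sum_smoothCell_mul (δ : ℝ) (u : ℕ → ℝ) (N : ℕ) (H : ℕ → smoothFunctions 𝕜) :
    ((∑ k ∈ Finset.range N, smoothCell 𝕜 δ (u k) * H k : smoothFunctions 𝕜) : ℝ → 𝕜) =
      fun t => ∑ k ∈ Finset.range N, cellCutoff 𝕜 δ (u k) t * (H k : ℝ → 𝕜) t := by
  funext t
  rw [AddSubmonoidClass.coe_finsetSum, Finset.sum_apply]
  rfl

/-- One-dimensional spectral synthesis: a closed ideal of `C^∞(ℝ)` is determined by the
multiplicities of its zeroes. -/
theorem mem_of_vanishesLike {I : Ideal (smoothFunctions 𝕜)}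
    (hI : IsClosed[smoothTopology 𝕜] (I : Set (smoothFunctions 𝕜))) {g : smoothFunctions 𝕜}
    (hg : VanishesLike I (g : ℝ → 𝕜)) : g ∈ I := by
  classical
  refine mem_of_forall_exists_approx hI g fun m η hη => ?_
  obtain ⟨A, hA0, hA⟩ := exists_partition 𝕜 m (R := (m : ℝ) + 1) (by positivity)
  -- Derivatives of order b ≤ m are expanded to order m + 2, at points at distance at most 2δ ≤ 2
  -- from [-(m + 1), m + 1].
  obtain ⟨B, hB0, hB⟩ := exists_norm_iteratedDeriv_le (contDiff_coe g) (m + (m + 2)) ((m : ℝ) + 3)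
  have hE : 0 < A * 2 ^ (m + 2) * B + 1 := by positivity
  set δ : ℝ := min 1 (η / (A * 2 ^ (m + 2) * B + 1)) with hδdef
  have hδ : 0 < δ := lt_min one_pos (div_pos hη hE)
  have hδ1 : δ ≤ 1 := min_le_left _ _
  have hδη : (A * 2 ^ (m + 2) * B + 1) * δ ≤ η := by
    rw [mul_comm, ← le_div_iff₀ hE]; exact min_le_right _ _
  obtain ⟨N, u, hsum, hglue⟩ := hA δ hδ hδ1
  -- On a good cell the piece of g lies in the ideal. A bad cell contains a point where g is flat,
  -- so there g and its derivatives up to order m are O(δ^(m+2)). This beats the gluing loss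
  -- δ^(-(m+1)), and these pieces, collected in `H`, may be discarded.
  let good : ℕ → Prop := fun k => ∀ x ∈ Icc (u k * δ) ((u k + 2) * δ), zeroMultiplicity I x ≠ ⊤
  let H : ℕ → smoothFunctions 𝕜 := fun k => if good k then 0 else g
  refine ⟨∑ k ∈ Finset.range N, smoothCell 𝕜 δ (u k) * (g - H k), ?_, fun j hj t ht => ?_⟩
  · refine I.sum_mem fun k _ => ?_
    by_cases hk : good k
    · obtain ⟨χ, h1, h2⟩ := exists_cutoff_mul_mem_of_isCompact hg isCompact_Icc hk
      have : smoothCell 𝕜 δ (u k) * (g - H k) = smoothCell 𝕜 δ (u k) * (χ * g) := by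
        simp only [H, if_pos hk, sub_zero]
        apply Subtype.ext
        funext s
        change cellCutoff 𝕜 δ (u k) s * (g : ℝ → 𝕜) s =
          cellCutoff 𝕜 δ (u k) s * ((χ : ℝ → 𝕜) s * (g : ℝ → 𝕜) s)
        by_cases hs : s ∈ Icc (u k * δ) ((u k + 2) * δ)
        · rw [h1 s hs, one_mul]
        · rw [(eventually_cellCutoff_eq_zero hδ hs).eq_of_nhds]; simp
      rw [this]
      exact I.mul_mem_left _ h2
    · simp [H, if_neg hk]
  · have htm : |t| ≤ m := abs_le.2 ht
    have heq : ((g - ∑ k ∈ Finset.range N, smoothCell 𝕜 δ (u k) * (g - H k) :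
        smoothFunctions 𝕜) : ℝ → 𝕜) =ᶠ[𝓝 t]
        fun s => ∑ k ∈ Finset.range N, cellCutoff 𝕜 δ (u k) s * (H k : ℝ → 𝕜) s := by
      have : ∀ᶠ s in 𝓝 t, |s| < (m : ℝ) + 1 :=
        continuous_abs.continuousAt.eventually (gt_mem_nhds (by linarith))
      filter_upwards [this] with s hs
      change (g : ℝ → 𝕜) s - ((∑ k ∈ Finset.range N, smoothCell 𝕜 δ (u k) * (g - H k) :
        smoothFunctions 𝕜) : ℝ → 𝕜) s = _
      rw [coe_sum_smoothCell_mul δ u N (fun k => g - H k)]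
      change (g : ℝ → 𝕜) s - ∑ k ∈ Finset.range N, cellCutoff 𝕜 δ (u k) s *
        ((g : ℝ → 𝕜) s - (H k : ℝ → 𝕜) s) = _
      simp only [mul_sub, Finset.sum_sub_distrib]
      rw [← Finset.sum_mul, hsum s hs.le]; ring
    rw [heq.iteratedDeriv_eq]
    have hbound := hglue (fun k => H k) (fun k => contDiff_coe (H k)) ((2 * δ) ^ (m + 2) * B)
      (by positivity) (fun k b hb s hs hsR => ?_) j hj t (by linarith)
    · have hδB : A * (δ ^ (m + 1))⁻¹ * ((2 * δ) ^ (m + 2) * B) = A * 2 ^ (m + 2) * B * δ := by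
        rw [mul_pow, pow_succ δ (m + 1)]
        field_simp
      rw [hδB] at hbound
      nlinarith
    · by_cases hk : good k
      · simp only [H, if_pos hk]
        have : ((0 : smoothFunctions 𝕜) : ℝ → 𝕜) = fun _ => 0 := rfl
        rw [this, iteratedDeriv_fun_const_zero, norm_zero]
        positivity
      · simp only [H, if_neg hk]
        simp only [good, not_forall, not_not] at hk
        obtain ⟨x, hx, hxt⟩ := hk
        have hsx : |s - x| ≤ 2 * δ := by
          rw [abs_le]; constructor <;> nlinarith [hs.1, hs.2, hx.1, hx.2]
        obtain ⟨hc, hit⟩ := (contDiff_coe g).contDiff_iteratedDeriv_infty b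
        obtain ⟨q, -, hq, hqB⟩ := exists_eq_sub_pow_mul hc x (m + 2)
          (fun i _ => by rw [hit]; exact hg x _ (by rw [hxt]; exact ENat.natCast_lt_top _))
        have hs' : s ∈ Icc (-((m : ℝ) + 3)) (m + 3) := by
          rw [abs_le] at hsR; constructor <;> linarith
        have hx' : x ∈ Icc (-((m : ℝ) + 3)) (m + 3) := by
          rw [abs_le] at hsR hsx; constructor <;> linarith
        have h1 := hqB _ (convex_Icc _ _) hx' B
          (fun r hr => by rw [hit]; exact hB _ (by omega) r hr) s hs'
        rw [hq s, norm_mul, norm_pow, ← RCLike.ofReal_sub, RCLike.norm_ofReal]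
        gcongr

theorem VanishesLike.of_mem {I : Ideal (smoothFunctions 𝕜)} {f : smoothFunctions 𝕜} (hf : f ∈ I) :
    VanishesLike I (f : ℝ → 𝕜) := fun _ _ hj => iteratedDeriv_eq_zero_of_mem hf hj

end ClosedIdeal

/-! ### The seminorms and their quotients. -/

section QuotientNorm

variable {𝕜 : Type*} [RCLike 𝕜]

theorem convexHull_subset_Icc {K : Set ℝ} {R : ℝ} (hK : ∀ x ∈ K, |x| ≤ R) :
    convexHull ℝ K ⊆ Icc (-R) R :=
  convexHull_min (fun x hx => abs_le.1 (hK x hx)) (convex_Icc _ _)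

theorem exists_abs_le_of_isCompact {K : Set ℝ} (hK : IsCompact K) : ∃ R : ℕ, ∀ x ∈ K, |x| ≤ R := by
  obtain ⟨R, hR⟩ := hK.exists_bound_of_continuousOn (f := fun x : ℝ => x) continuousOn_id
  exact ⟨⌈R⌉₊, fun x hx => (hR x hx).trans (Nat.le_ceil R)⟩

theorem bddAbove_smoothNorm {K : Set ℝ} (hK : IsCompact K) (n : ℕ) (F : smoothFunctions 𝕜) :
    BddAbove {a : ℝ | ∃ j ≤ n, ∃ x ∈ convexHull ℝ K ∪ Icc (-(n : ℝ)) n,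
      a = ‖iteratedDeriv j (F : ℝ → 𝕜) x‖} := by
  obtain ⟨R, hR⟩ := exists_abs_le_of_isCompact hK
  obtain ⟨B, -, hB⟩ := exists_norm_iteratedDeriv_le (contDiff_coe F) n ((R : ℝ) + n)
  refine ⟨B, ?_⟩
  rintro a ⟨j, hj, x, hx, rfl⟩
  refine hB j hj x ?_
  have h1 : (0 : ℝ) ≤ R := R.cast_nonneg
  have h2 : (0 : ℝ) ≤ n := n.cast_nonneg
  rcases hx with hx | hx
  · exact Icc_subset_Icc (by linarith) (by linarith) (convexHull_subset_Icc hR hx)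
  · exact Icc_subset_Icc (by linarith) (by linarith) hx

theorem norm_iteratedDeriv_le_smoothNorm {K : Set ℝ} (hK : IsCompact K) {n j : ℕ} (hj : j ≤ n)
    (F : smoothFunctions 𝕜) {x : ℝ} (hx : x ∈ convexHull ℝ K ∪ Icc (-(n : ℝ)) n) :
    ‖iteratedDeriv j (F : ℝ → 𝕜) x‖ ≤ smoothNorm K n F :=
  le_csSup (bddAbove_smoothNorm hK n F) ⟨j, hj, x, hx, rfl⟩

theorem smoothNorm_le {K : Set ℝ} {n : ℕ} {F : smoothFunctions 𝕜} {B : ℝ}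
    (h : ∀ j ≤ n, ∀ x ∈ convexHull ℝ K ∪ Icc (-(n : ℝ)) n,
      ‖iteratedDeriv j (F : ℝ → 𝕜) x‖ ≤ B) : smoothNorm K n F ≤ B := by
  refine csSup_le ⟨_, 0, n.zero_le, 0, Or.inr (by simp), rfl⟩ ?_
  rintro a ⟨j, hj, x, hx, rfl⟩
  exact h j hj x hx

theorem smoothNorm_nonneg (K : Set ℝ) (n : ℕ) (F : smoothFunctions 𝕜) : 0 ≤ smoothNorm K n F := by
  refine Real.sSup_nonneg ?_
  rintro a ⟨j, hj, x, hx, rfl⟩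
  exact norm_nonneg _

theorem smoothNorm_mono {K : Set ℝ} (hK : IsCompact K) {n m : ℕ} (hnm : n ≤ m)
    (F : smoothFunctions 𝕜) : smoothNorm K n F ≤ smoothNorm K m F := by
  refine smoothNorm_le fun j hj x hx =>
    norm_iteratedDeriv_le_smoothNorm hK (hj.trans hnm) F (hx.imp_right fun h => ?_)
  have : (n : ℝ) ≤ m := by exact_mod_cast hnm
  exact Icc_subset_Icc (by linarith) this h

theorem quotientNorm_nonneg (I : Ideal (smoothFunctions 𝕜)) (n : ℕ) (f : smoothFunctions 𝕜 ⧸ I) :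
    0 ≤ quotientNorm I n f := by
  refine Real.sInf_nonneg ?_
  rintro a ⟨F, -, rfl⟩
  exact smoothNorm_nonneg _ _ _

theorem quotientNorm_mk_le (I : Ideal (smoothFunctions 𝕜)) (n : ℕ) (F : smoothFunctions 𝕜) :
    quotientNorm I n (Ideal.Quotient.mk I F) ≤ smoothNorm (zeroSet I) n F := by
  refine csInf_le ⟨0, ?_⟩ ⟨F, rfl, rfl⟩
  rintro a ⟨F, -, rfl⟩
  exact smoothNorm_nonneg _ _ _

theorem exists_smoothNorm_lt (I : Ideal (smoothFunctions 𝕜)) (n : ℕ) (f : smoothFunctions 𝕜 ⧸ I)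
    {η : ℝ} (hη : 0 < η) : ∃ F : smoothFunctions 𝕜, Ideal.Quotient.mk I F = f ∧
      smoothNorm (zeroSet I) n F < quotientNorm I n f + η := by
  obtain ⟨F, hF⟩ := Ideal.Quotient.mk_surjective f
  obtain ⟨a, ⟨G, hG, rfl⟩, hlt⟩ := Real.lt_sInf_add_pos (s := {a : ℝ | ∃ F : smoothFunctions 𝕜,
    Ideal.Quotient.mk I F = f ∧ a = smoothNorm (zeroSet I) n F}) ⟨_, F, hF, rfl⟩ hη
  exact ⟨G, hG, hlt⟩

theorem quotientNorm_mono {I : Ideal (smoothFunctions 𝕜)} (hK : IsCompact (zeroSet I)) {n m : ℕ}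
    (hnm : n ≤ m) (f : smoothFunctions 𝕜 ⧸ I) : quotientNorm I n f ≤ quotientNorm I m f := by
  refine le_of_forall_pos_le_add fun η hη => ?_
  obtain ⟨F, rfl, hF⟩ := exists_smoothNorm_lt I m f hη
  exact (quotientNorm_mk_le I n F).trans ((smoothNorm_mono hK hnm F).trans hF.le)

/-- If the ideal is closed, only the zero class is annihilated by all quotient norms. -/
theorem eq_zero_of_quotientNorm_eq_zero {I : Ideal (smoothFunctions 𝕜)}
    (hI : IsClosed[smoothTopology 𝕜] (I : Set (smoothFunctions 𝕜)))
    (hK : IsCompact (zeroSet I)) {f : smoothFunctions 𝕜 ⧸ I}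
    (h : ∀ m, quotientNorm I m f = 0) : f = 0 := by
  obtain ⟨F, rfl⟩ := Ideal.Quotient.mk_surjective f
  rw [Ideal.Quotient.eq_zero_iff_mem]
  refine mem_of_forall_exists_approx hI F fun m η hη => ?_
  obtain ⟨G, hG, hlt⟩ := exists_smoothNorm_lt I m (Ideal.Quotient.mk I F) hη
  rw [h m, zero_add] at hlt
  refine ⟨F - G, Ideal.Quotient.eq.1 hG.symm, fun j hj t ht => ?_⟩
  rw [sub_sub_cancel]
  exact (norm_iteratedDeriv_le_smoothNorm hK hj G (Or.inr ht)).trans hlt.le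

end QuotientNorm

/-! ### Local estimates: few zeroes or a Markov inequality. -/

section LocalRepresentatives

variable {𝕜 : Type*} [RCLike 𝕜]

theorem contDiff_multiset_prod_sub (M : Multiset ℝ) :
    ContDiff ℝ ∞ fun t : ℝ => (M.map fun x : ℝ => (t : 𝕜) - x).prod := by
  induction M using Multiset.induction with
  | empty => simpa using contDiff_const
  | cons x M ih =>
    simp only [Multiset.map_cons, Multiset.prod_cons]
    exact (contDiff_ofReal.sub contDiff_const).mul ih

/-- If `I` has at most `n` zeroes in `J`, its zeroes in `J` form a multiset of size `≤ n`. -/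
theorem exists_multiset_of_numZeros_le {I : Ideal (smoothFunctions 𝕜)} {J : Set ℝ} {n : ℕ}
    (h : numZeros I J ≤ n) : ∃ M : Multiset ℝ, M.card ≤ n ∧ (∀ x ∈ M, x ∈ zeroSet I) ∧
      ∀ x ∈ J, ∃ p : ℕ, zeroMultiplicity I x = p ∧ Multiset.replicate p x ≤ M := by
  classical
  have hsum : ∀ s : Finset ℝ, (s : Set ℝ) ⊆ J → ∑ x ∈ s, zeroMultiplicity I x ≤ n := fun s hs =>
    (le_iSup (fun s : {s : Finset ℝ // (s : Set ℝ) ⊆ J} => ∑ x ∈ s.1, zeroMultiplicity I x)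
      ⟨s, hs⟩).trans h
  have hfin : (zeroSet I ∩ J).Finite := by
    by_contra hinf
    obtain ⟨s, hs, hcard⟩ := Set.Infinite.exists_subset_card_eq hinf (n + 1)
    have h1 := hsum s (hs.trans inter_subset_right)
    have h2 : ∑ x ∈ s, (1 : ℕ∞) ≤ ∑ x ∈ s, zeroMultiplicity I x :=
      Finset.sum_le_sum fun x hx => Order.one_le_iff_pos.2 (hs hx).1
    rw [Finset.sum_const, hcard, nsmul_eq_mul, mul_one] at h2
    exact absurd (Nat.cast_le.1 (h2.trans h1)) (by omega)
  have hne : ∀ x ∈ J, zeroMultiplicity I x ≠ ⊤ := by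
    intro x hx htop
    have := hsum {x} (by simpa using hx)
    rw [Finset.sum_singleton, htop] at this
    exact absurd this (by simp)
  refine ⟨∑ x ∈ hfin.toFinset, Multiset.replicate (zeroMultiplicity I x).toNat x, ?_, ?_, ?_⟩
  · rw [Multiset.card_sum]
    simp only [Multiset.card_replicate]
    have h1 := hsum hfin.toFinset (by simp)
    have h2 : ((∑ x ∈ hfin.toFinset, (zeroMultiplicity I x).toNat : ℕ) : ℕ∞) =
        ∑ x ∈ hfin.toFinset, zeroMultiplicity I x := by
      push_cast
      refine Finset.sum_congr rfl fun x hx => ENat.natCast_toNat (hne x ?_)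
      exact ((hfin.mem_toFinset).1 hx).2
    rw [← h2] at h1
    exact_mod_cast h1
  · intro x hx
    rw [Multiset.mem_sum] at hx
    obtain ⟨y, hy, hxy⟩ := hx
    rw [Multiset.eq_of_mem_replicate hxy]
    exact ((hfin.mem_toFinset).1 hy).1
  · intro x hx
    refine ⟨(zeroMultiplicity I x).toNat, (ENat.natCast_toNat (hne x hx)).symm, ?_⟩
    by_cases h0 : zeroMultiplicity I x = 0
    · simp [h0]
    · exact Finset.single_le_sum (f := fun x => Multiset.replicate (zeroMultiplicity I x).toNat x)
        (fun _ _ => Multiset.zero_le _) (hfin.mem_toFinset.2 ⟨pos_iff_ne_zero.2 h0, hx⟩)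

/-- Where the ideal has few zeroes, Hermite interpolation gives a local representative that is
bounded by few derivatives. -/
theorem exists_local_representative_of_numZeros_le {I : Ideal (smoothFunctions 𝕜)} {J : Set ℝ}
    {n : ℕ} (h : numZeros I J ≤ (n : ℕ∞) + 1) (F : smoothFunctions 𝕜) {R : ℝ} (hR : 0 ≤ R)
    (hKR : ∀ x ∈ zeroSet I, |x| ≤ R) {B : ℝ} (hB : 0 ≤ B)
    (hF : ∀ j ≤ n, ∀ t ∈ convexHull ℝ (zeroSet I), ‖iteratedDeriv j (F : ℝ → 𝕜) t‖ ≤ B) (m : ℕ) :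
    ∃ H : smoothFunctions 𝕜,
      (∀ x ∈ J, ∀ j : ℕ, (j : ℕ∞) < zeroMultiplicity I x →
        iteratedDeriv j ((F - H : smoothFunctions 𝕜) : ℝ → 𝕜) x = 0) ∧
      ∀ b ≤ m, ∀ t, |t| ≤ R →
        ‖iteratedDeriv b (H : ℝ → 𝕜) t‖ ≤ (2 * R + m + 1) ^ (n + 1) * B := by
  -- With at most n + 1 nodes the interpolation bound needs only derivatives of order at most n.
  obtain ⟨M, hcard, hMK, hM⟩ := exists_multiset_of_numZeros_le (n := n + 1) (by exact_mod_cast h)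
  obtain ⟨P, g, hg, -, hP, -, hPB⟩ := exists_hermite_interpolation M (contDiff_coe F)
  refine ⟨⟨_, contDiff_eval P⟩, fun x hx j hj => ?_, fun b hb t ht => ?_⟩
  · obtain ⟨p, hp, hpM⟩ := hM x hx
    obtain ⟨M', rfl⟩ := Multiset.le_iff_exists_add.1 hpM
    have : ((F - ⟨_, contDiff_eval P⟩ : smoothFunctions 𝕜) : ℝ → 𝕜) = fun t : ℝ =>
        ((t : 𝕜) - x) ^ p * ((M'.map fun x : ℝ => (t : 𝕜) - x).prod * g t) := by
      funext t
      change (F : ℝ → 𝕜) t - P.eval (t : 𝕜) = _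
      rw [hP t, Multiset.map_add, Multiset.prod_add, Multiset.map_replicate,
        Multiset.prod_replicate]
      ring
    rw [this]
    refine iteratedDeriv_sub_pow_mul_eq_zero ((contDiff_multiset_prod_sub M').mul hg) x ?_
    rw [hp] at hj
    exact_mod_cast hj
  · change ‖iteratedDeriv b (fun t : ℝ => P.eval (t : 𝕜)) t‖ ≤ _
    rw [iteratedDeriv_eval]
    -- The nodes lie in K, so conv(K) is an admissible convex set; this is why the norms include
    -- conv(K).
    refine (hPB _ (convex_convexHull ℝ _) (fun x hx => subset_convexHull ℝ _ (hMK x hx)) B hB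
      (fun j hj => hF j (by omega)) R hR (fun x hx => hKR x (hMK x hx)) m b hb t ht).trans ?_
    gcongr
    have : (0 : ℝ) ≤ m := m.cast_nonneg
    linarith

/-- Where a local Markov inequality holds, the derivatives of `G` are controlled by the values of
`G` on `K`, up to a small multiple of the higher derivatives. -/
theorem norm_iteratedDeriv_le_of_localMarkov {K : Set ℝ} {G : smoothFunctions 𝕜} {L k m : ℕ}
    (hLk : L < k) (hmL : m ≤ L) {A ε y R BF BG : ℝ} (hA : 0 ≤ A) (hε : 0 < ε) (hε1 : ε ≤ 1)
    (hy : y ∈ K) (hKR : ∀ x ∈ K, |x| ≤ R) (hM : LocalMarkov 𝕜 K L k A ε y)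
    (hBF : ∀ t ∈ K, ‖(G : ℝ → 𝕜) t‖ ≤ BF)
    (hBG : ∀ j ≤ k, ∀ t, |t| ≤ R → ‖iteratedDeriv j (G : ℝ → 𝕜) t‖ ≤ BG)
    {b : ℕ} (hb : b ≤ m) {t : ℝ} (ht : |t| ≤ R) (hty : |t - y| ≤ 2 * ε) :
    ‖iteratedDeriv b (G : ℝ → 𝕜) t‖ ≤
      (2 * R + 1) ^ (L + 1) * (A * (BF + ε ^ k * BG)) + 2 ^ (L + 1) * (ε ^ (L + 1 - m) * BG) := by
  have hR0 : 0 ≤ R := (abs_nonneg y).trans (hKR y hy)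
  have hBG0 : 0 ≤ BG := (norm_nonneg _).trans (hBG 0 (Nat.zero_le _) y (hKR y hy))
  have hBF0 : 0 ≤ BF := (norm_nonneg _).trans (hBF y hy)
  have hyR : y ∈ Icc (-R) R := abs_le.1 (hKR y hy)
  have hderiv : ∀ j ≤ L, ‖iteratedDeriv j (G : ℝ → 𝕜) y‖ ≤ A * (BF + ε ^ k * BG) := by
    intro j hj
    -- Within ε of y the Taylor polynomial differs from `G` on K by at most ε^k `BG`, so the Markov
    -- inequality bounds the derivatives of `G` at y.
    obtain ⟨P, g, -, hdeg, hP, hPy, hgB, -⟩ := exists_taylor (contDiff_coe G) y k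
    rw [← hPy j (by omega)]
    refine (hM P hdeg j hj).trans ?_
    gcongr
    refine csSup_le ⟨_, y, ⟨hy, by constructor <;> linarith⟩, rfl⟩ ?_
    rintro a ⟨s, ⟨hsK, hsε⟩, rfl⟩
    have h1 : P.eval (s : 𝕜) = (G : ℝ → 𝕜) s - ((s : 𝕜) - y) ^ k * g s := by rw [hP s]; ring
    rw [h1]
    refine (norm_sub_le _ _).trans (add_le_add (hBF s hsK) ?_)
    rw [norm_mul, norm_pow, ← RCLike.ofReal_sub, RCLike.norm_ofReal]
    have h2 : |s - y| ≤ ε := by rw [abs_le]; constructor <;> linarith [hsε.1, hsε.2]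
    have h3 := hgB (Icc (-R) R) (convex_Icc _ _) hyR BG
      (fun r hr => hBG k le_rfl r (abs_le.2 hr)) s (abs_le.1 (hKR s hsK))
    gcongr
  obtain ⟨hc, hit⟩ := (contDiff_coe G).contDiff_iteratedDeriv_infty b
  -- A second expansion, now of the `b`-th derivative, carries the bounds from y to t; it uses
  -- exactly the orders up to L controlled at y.
  obtain ⟨P, g, -, -, hP, -, hgB, hPB⟩ := exists_taylor hc y (L + 1 - b)
  have hW : 0 ≤ A * (BF + ε ^ k * BG) := by positivity
  have h1 := hPB _ hW (fun j hj => by rw [hit]; exact hderiv _ (by omega)) R hR0 (hKR y hy) t ht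
  have h2 := hgB (Icc (-R) R) (convex_Icc _ _) hyR BG
    (fun r hr => by rw [hit]; exact hBG _ (by omega) r (abs_le.2 hr)) t (abs_le.1 ht)
  rw [hP t]
  refine (norm_add_le _ _).trans (add_le_add (h1.trans ?_) ?_)
  · gcongr
    · linarith
    · omega
  · rw [norm_mul, norm_pow, ← RCLike.ofReal_sub, RCLike.norm_ofReal, ← mul_assoc]
    calc |t - y| ^ (L + 1 - b) * ‖g t‖ ≤ (2 * ε) ^ (L + 1 - b) * BG := by gcongr
      _ = 2 ^ (L + 1 - b) * ε ^ (L + 1 - b) * BG := by rw [mul_pow]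
      _ ≤ 2 ^ (L + 1) * ε ^ (L + 1 - m) * BG := by
        gcongr ?_ * ?_ * BG
        · exact pow_le_pow_right₀ one_le_two (by omega)
        · exact pow_le_pow_of_le_one hε.le hε1 (by omega)

end LocalRepresentatives

/-! ### Gluing and the estimate on the scale ε. -/

section GlobalEstimate

variable {𝕜 : Type*} [RCLike 𝕜]

theorem numZeros_mono (I : Ideal (smoothFunctions 𝕜)) {J J' : Set ℝ} (h : J ⊆ J') :
    numZeros I J ≤ numZeros I J' :=
  iSup_le fun s => le_iSup (fun s : {s : Finset ℝ // (s : Set ℝ) ⊆ J'} =>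
    ∑ x ∈ s.1, zeroMultiplicity I x) ⟨s.1, s.2.trans h⟩

theorem LocalMarkov.mono {K : Set ℝ} {m k : ℕ} {A A' ε y : ℝ} (h : LocalMarkov 𝕜 K m k A ε y)
    (hA : A ≤ A') : LocalMarkov 𝕜 K m k A' ε y := fun P hP j hj =>
  (h P hP j hj).trans (mul_le_mul_of_nonneg_right hA (Real.sSup_nonneg (by
    rintro a ⟨t, -, rfl⟩; exact norm_nonneg _)))

/-- The exponents in `FewZerosOrMarkov` can be taken to be natural numbers. -/
theorem FewZerosOrMarkov.exists_nat {I : Ideal (smoothFunctions 𝕜)} {n : ℕ}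
    (h : FewZerosOrMarkov I n) : ∃ r γ : ℕ, 1 ≤ r ∧ ∀ m k : ℕ, 1 ≤ m → 1 ≤ k →
      ∃ c > (0 : ℝ), ∃ ε₀ ∈ Ioo (0 : ℝ) 1, ∀ x ∈ zeroSet I, ∀ ε : ℝ, 0 < ε → ε < ε₀ →
        numZeros I (Ioo (x - ε ^ r) (x + ε ^ r)) ≤ (n : ℕ∞) + 1 ∨
        ∃ y ∈ zeroSet I ∩ Ioo (x - ε) (x + ε),
          LocalMarkov 𝕜 (zeroSet I) m k (c * (ε ^ (γ * m))⁻¹) ε y := by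
  obtain ⟨r, hr, γ, -, h⟩ := h
  have hr' : r ≤ ⌈r⌉₊ := Nat.le_ceil r
  refine ⟨⌈r⌉₊, ⌈γ⌉₊, ?_, fun m k hm hk => ?_⟩
  · exact_mod_cast hr.trans hr'
  obtain ⟨c, hc, ε₀, hε₀, h⟩ := h m k hm hk
  refine ⟨c, hc, ε₀, hε₀, fun x hx ε hε hεε₀ => ?_⟩
  have hε1 : ε ≤ 1 := hεε₀.le.trans hε₀.2.le
  rcases h x hx ε hε hεε₀ with h | ⟨y, hy, h⟩
  · refine Or.inl ((numZeros_mono I ?_).trans h)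
    have : ε ^ ⌈r⌉₊ ≤ ε ^ r := by
      rw [← Real.rpow_natCast]
      exact Real.rpow_le_rpow_of_exponent_ge hε hε1 hr'
    exact Ioo_subset_Ioo (by linarith) (by linarith)
  · refine Or.inr ⟨y, hy, h.mono ?_⟩
    rw [div_eq_mul_inv]
    have : ε ^ (⌈γ⌉₊ * m) ≤ ε ^ (γ * (m : ℝ)) := by
      rw [← Real.rpow_natCast]
      refine Real.rpow_le_rpow_of_exponent_ge hε hε1 ?_
      push_cast
      gcongr
      exact Nat.le_ceil γ
    gcongr

theorem coe_mul_smoothFunctions (f g : smoothFunctions 𝕜) :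
    ((f * g : smoothFunctions 𝕜) : ℝ → 𝕜) = fun t => (f : ℝ → 𝕜) t * (g : ℝ → 𝕜) t := rfl

/-- Off the cell the cutoff vanishes locally, so only zeroes inside the cell impose conditions on
`D`; spectral synthesis then gives membership. -/
theorem smoothCell_mul_mem {I : Ideal (smoothFunctions 𝕜)}
    (hI : IsClosed[smoothTopology 𝕜] (I : Set (smoothFunctions 𝕜))) {δ u : ℝ} (hδ : 0 < δ)
    {D : smoothFunctions 𝕜} (hD : ∀ x ∈ Icc (u * δ) ((u + 2) * δ), ∀ j : ℕ,
      (j : ℕ∞) < zeroMultiplicity I x → iteratedDeriv j (D : ℝ → 𝕜) x = 0) :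
    smoothCell 𝕜 δ u * D ∈ I := by
  refine mem_of_vanishesLike hI fun x j hj => ?_
  rw [mul_comm, coe_mul_smoothFunctions]
  by_cases hx : x ∈ Icc (u * δ) ((u + 2) * δ)
  · exact iteratedDeriv_mul_eq_zero (contDiff_coe D) (contDiff_cellCutoff δ u) fun a ha =>
      hD x hx a (lt_of_le_of_lt (Nat.cast_le.2 ha) hj)
  · have : (fun t => (D : ℝ → 𝕜) t * (smoothCell 𝕜 δ u : ℝ → 𝕜) t) =ᶠ[𝓝 x] fun _ => 0 := by
      filter_upwards [eventually_cellCutoff_eq_zero (𝕜 := 𝕜) hδ hx] with s hs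
      change (D : ℝ → 𝕜) s * cellCutoff 𝕜 δ u s = 0
      rw [hs, mul_zero]
    rw [this.iteratedDeriv_eq, iteratedDeriv_fun_const_zero]

/-- Local representatives on the cells of a partition of unity are glued to a global one. -/
theorem mk_sum_smoothCell_mul {I : Ideal (smoothFunctions 𝕜)}
    (hI : IsClosed[smoothTopology 𝕜] (I : Set (smoothFunctions 𝕜))) {δ R : ℝ} (hδ : 0 < δ)
    (hKR : ∀ x ∈ zeroSet I, |x| < R) {N : ℕ} {u : ℕ → ℝ}
    (hu : ∀ t : ℝ, |t| ≤ R → ∑ k ∈ Finset.range N, cellCutoff 𝕜 δ (u k) t = 1)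
    (F : smoothFunctions 𝕜) (H : ℕ → smoothFunctions 𝕜)
    (hH : ∀ k, ∀ x ∈ Icc (u k * δ) ((u k + 2) * δ), ∀ j : ℕ,
      (j : ℕ∞) < zeroMultiplicity I x →
        iteratedDeriv j ((F - H k : smoothFunctions 𝕜) : ℝ → 𝕜) x = 0) :
    Ideal.Quotient.mk I (∑ k ∈ Finset.range N, smoothCell 𝕜 δ (u k) * H k) =
      Ideal.Quotient.mk I F := by
  rw [eq_comm, Ideal.Quotient.eq]
  -- The first sum lies in the ideal cell by cell; the last difference vanishes near K, where the
  -- partition sums to 1.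
  have hsplit : F - ∑ k ∈ Finset.range N, smoothCell 𝕜 δ (u k) * H k =
      ∑ k ∈ Finset.range N, smoothCell 𝕜 δ (u k) * (F - H k) +
        (F - ∑ k ∈ Finset.range N, smoothCell 𝕜 δ (u k) * F) := by
    simp only [mul_sub, Finset.sum_sub_distrib]; ring
  rw [hsplit]
  refine I.add_mem (I.sum_mem fun k _ => smoothCell_mul_mem hI hδ (hH k)) ?_
  refine mem_of_vanishesLike hI fun x j hj => ?_
  have hxK : x ∈ zeroSet I := lt_of_le_of_lt (zero_le) hj
  have : ((F - ∑ k ∈ Finset.range N, smoothCell 𝕜 δ (u k) * F : smoothFunctions 𝕜) : ℝ → 𝕜)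
      =ᶠ[𝓝 x] fun _ => 0 := by
    filter_upwards [continuous_abs.continuousAt.eventually (gt_mem_nhds (hKR x hxK))] with s hs
    change (F : ℝ → 𝕜) s - ((∑ k ∈ Finset.range N, smoothCell 𝕜 δ (u k) * F :
      smoothFunctions 𝕜) : ℝ → 𝕜) s = 0
    rw [coe_sum_smoothCell_mul δ u N (fun _ => F)]
    simp only
    rw [← Finset.sum_mul, hu s hs.le, one_mul, sub_self]
  rw [this.iteratedDeriv_eq, iteratedDeriv_fun_const_zero]

/-- On every cell there is a local representative of the class of `F` with good bounds. -/
theorem exists_local_representative {I : Ideal (smoothFunctions 𝕜)}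
    (hK : IsCompact (zeroSet I)) {n r γ m L k k' R : ℕ} {c ε δ : ℝ} (hc : 0 < c) (hr : 1 ≤ r)
    (hmL : m ≤ L) (hk : k = γ * L + L + 1) (hkk' : k ≤ k') (hRk' : R ≤ k')
    (hKR : ∀ x ∈ zeroSet I, |x| ≤ R) (hε : 0 < ε) (hε1 : ε ≤ 1) (hδ : δ = ε ^ r / 4)
    (h : ∀ x ∈ zeroSet I, numZeros I (Ioo (x - ε ^ r) (x + ε ^ r)) ≤ (n : ℕ∞) + 1 ∨
      ∃ y ∈ zeroSet I ∩ Ioo (x - ε) (x + ε),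
        LocalMarkov 𝕜 (zeroSet I) L k (c * (ε ^ (γ * L))⁻¹) ε y)
    {F G : smoothFunctions 𝕜} (hFG : F - G ∈ I) (u : ℝ) :
    ∃ H : smoothFunctions 𝕜,
      (∀ x ∈ Icc (u * δ) ((u + 2) * δ), ∀ j : ℕ, (j : ℕ∞) < zeroMultiplicity I x →
        iteratedDeriv j ((F - H : smoothFunctions 𝕜) : ℝ → 𝕜) x = 0) ∧
      ∀ b ≤ m, ∀ t ∈ Icc (u * δ) ((u + 2) * δ), |t| ≤ R →
        ‖iteratedDeriv b (H : ℝ → 𝕜) t‖ ≤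
          ((2 * R + m + 1) ^ (n + 1) + (2 * R + 1) ^ (L + 1) * c + 2 ^ (L + 1)) *
            ((ε ^ (γ * L))⁻¹ * smoothNorm (zeroSet I) n F +
              ε ^ (L + 1 - m) * smoothNorm (zeroSet I) k' G) := by
  set BF := smoothNorm (zeroSet I) n F with hBFdef
  set BG := smoothNorm (zeroSet I) k' G with hBGdef
  have hBF0 : 0 ≤ BF := smoothNorm_nonneg _ _ _
  have hBG0 : 0 ≤ BG := smoothNorm_nonneg _ _ _
  have hεr : 0 < ε ^ r := pow_pos hε r
  have hεr1 : ε ^ r ≤ ε := by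
    simpa using pow_le_pow_of_le_one hε.le hε1 hr
  have hinv : 1 ≤ (ε ^ (γ * L))⁻¹ := (one_le_inv₀ (by positivity)).2 (pow_le_one₀ hε.le hε1)
  have hX : BF ≤ (ε ^ (γ * L))⁻¹ * BF := le_mul_of_one_le_left hBF0 hinv
  have hY : 0 ≤ ε ^ (L + 1 - m) * BG := by positivity
  by_cases hcell : ∃ x ∈ Icc (u * δ) ((u + 2) * δ), x ∈ zeroSet I
  swap
  · refine ⟨0, fun x hx j hj => absurd ⟨x, hx, lt_of_le_of_lt zero_le hj⟩ hcell,
      fun b _ t _ _ => ?_⟩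
    have : ((0 : smoothFunctions 𝕜) : ℝ → 𝕜) = fun _ => 0 := rfl
    rw [this, iteratedDeriv_fun_const_zero, norm_zero]
    positivity
  obtain ⟨x, hx, hxK⟩ := hcell
  -- A cell has length 2δ = ε^r/2 < ε^r.
  have hclose : ∀ t ∈ Icc (u * δ) ((u + 2) * δ), |t - x| < ε ^ r := by
    intro t ht
    rw [abs_lt]; constructor <;> nlinarith [ht.1, ht.2, hx.1, hx.2]
  rcases h x hxK with h | ⟨y, ⟨hyK, hyx⟩, hM⟩
  · obtain ⟨H, hH, hHB⟩ := exists_local_representative_of_numZeros_le h F (R.cast_nonneg) hKR hBF0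
      (fun j hj t ht => norm_iteratedDeriv_le_smoothNorm hK hj F (Or.inl ht)) m
    refine ⟨H, fun t ht => hH t ?_, fun b hb t _ htR => (hHB b hb t htR).trans ?_⟩
    · have := abs_lt.1 (hclose t ht)
      constructor <;> linarith
    · have h1 : (0 : ℝ) ≤ (2 * R + 1) ^ (L + 1) * c + 2 ^ (L + 1) := by positivity
      have h2 : (0 : ℝ) ≤ (2 * R + m + 1) ^ (n + 1) := by positivity
      calc (2 * R + m + 1) ^ (n + 1) * BF
          ≤ (2 * R + m + 1) ^ (n + 1) * ((ε ^ (γ * L))⁻¹ * BF + ε ^ (L + 1 - m) * BG) := by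
            gcongr; linarith
        _ ≤ _ := by gcongr; linarith
  · refine ⟨G, fun t _ j hj => iteratedDeriv_eq_zero_of_mem hFG hj, fun b hb t ht htR => ?_⟩
    have hRk'' : (R : ℝ) ≤ k' := by exact_mod_cast hRk'
    have hty : |t - y| ≤ 2 * ε := by
      have := abs_lt.1 (hclose t ht)
      rw [abs_le]; constructor <;> linarith [hyx.1, hyx.2]
    refine (norm_iteratedDeriv_le_of_localMarkov (BF := BF) (BG := BG) (by omega) hmL
      (by positivity) hε hε1 hyK hKR hM (fun s hs => ?_) (fun j hj s hs => ?_) hb htR hty).trans ?_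
    · have h0 := iteratedDeriv_eq_zero_of_mem hFG (x := s) (j := 0) (by exact_mod_cast hs)
      rw [iteratedDeriv_zero] at h0
      have h1 : (G : ℝ → 𝕜) s = (F : ℝ → 𝕜) s := (sub_eq_zero.1 h0).symm
      rw [h1]
      simpa using norm_iteratedDeriv_le_smoothNorm hK (Nat.zero_le n) F
        (Or.inl (subset_convexHull ℝ _ hs))
    · refine norm_iteratedDeriv_le_smoothNorm hK (hj.trans hkk') G (Or.inr ?_)
      exact abs_le.1 (hs.trans hRk'')
    · have hεk : (ε ^ (γ * L))⁻¹ * ε ^ k ≤ ε ^ (L + 1 - m) := by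
        rw [hk, add_assoc, pow_add, inv_mul_cancel_left₀ (by positivity)]
        exact pow_le_pow_of_le_one hε.le hε1 (by omega)
      have h1 : c * (ε ^ (γ * L))⁻¹ * (BF + ε ^ k * BG) ≤
          c * ((ε ^ (γ * L))⁻¹ * BF + ε ^ (L + 1 - m) * BG) := by
        have : c * (ε ^ (γ * L))⁻¹ * (BF + ε ^ k * BG) =
          c * ((ε ^ (γ * L))⁻¹ * BF + ((ε ^ (γ * L))⁻¹ * ε ^ k) * BG) := by ring
        rw [this]
        gcongr
      have h2 : ε ^ (L + 1 - m) * BG ≤ (ε ^ (γ * L))⁻¹ * BF + ε ^ (L + 1 - m) * BG := by linarith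
      have h3 : (0 : ℝ) ≤ (2 * R + m + 1) ^ (n + 1) *
        ((ε ^ (γ * L))⁻¹ * BF + ε ^ (L + 1 - m) * BG) := by positivity
      calc (2 * R + 1) ^ (L + 1) * (c * (ε ^ (γ * L))⁻¹ * (BF + ε ^ k * BG)) +
            2 ^ (L + 1) * (ε ^ (L + 1 - m) * BG)
          ≤ (2 * R + 1) ^ (L + 1) * (c * ((ε ^ (γ * L))⁻¹ * BF + ε ^ (L + 1 - m) * BG)) +
            2 ^ (L + 1) * ((ε ^ (γ * L))⁻¹ * BF + ε ^ (L + 1 - m) * BG) := by gcongr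
        _ ≤ _ := by linarith

/-- The quotient norms satisfy interpolation inequalities on all small scales, with a ratio of the
exponents that does not depend on `m`. -/
theorem exists_quotientNorm_le_scale {I : Ideal (smoothFunctions 𝕜)}
    (hI : IsClosed[smoothTopology 𝕜] (I : Set (smoothFunctions 𝕜)))
    (hK : IsCompact (zeroSet I)) {n : ℕ} (h : FewZerosOrMarkov I n) :
    ∃ A : ℕ, 1 ≤ A ∧ ∀ m : ℕ, ∃ k ≥ m, ∃ Q ≥ 1, ∃ C > (0 : ℝ), ∃ ε₀ > (0 : ℝ),
      ∀ f : smoothFunctions 𝕜 ⧸ I, ∀ ε : ℝ, 0 < ε → ε < ε₀ →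
        quotientNorm I m f ≤
          C * ((ε ^ (A * Q))⁻¹ * quotientNorm I n f + ε ^ Q * quotientNorm I k f) := by
  obtain ⟨r, γ, hr, h⟩ := h.exists_nat
  refine ⟨2 * γ + 1, by omega, fun m => ?_⟩
  obtain ⟨R₀, hR₀⟩ := exists_abs_le_of_isCompact hK
  set R : ℕ := max R₀ m + 1 with hRdef
  have hR₀R : (R₀ : ℝ) < R := by exact_mod_cast Nat.lt_succ_of_le (le_max_left R₀ m)
  have hmR : (m : ℝ) ≤ R := by exact_mod_cast (le_max_right R₀ m).trans (Nat.le_succ _)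
  have hKR : ∀ x ∈ zeroSet I, |x| < R := fun x hx => (hR₀ x hx).trans_lt hR₀R
  -- With L = 2Q, the gain ε^(L+1-m) pays the gluing loss ε^(-r(m+1)) and leaves more than ε^Q. The
  -- total loss exponent r(m+1) + γL is at most (2γ+1)Q, so its ratio to Q is bounded independently
  -- of m.
  set Q : ℕ := m + r * (m + 1) with hQ
  have hQr : r * (m + 1) ≤ Q := Nat.le_add_left _ _
  have hQ1 : 1 ≤ Q := le_trans (Nat.mul_pos hr (Nat.succ_pos m)) hQr
  set L : ℕ := 2 * Q with hL
  set k : ℕ := γ * L + L + 1 with hk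
  obtain ⟨c, hc, ε₀, hε₀, h⟩ := h L k (by omega) (by omega)
  obtain ⟨A, hA0, hA⟩ := exists_partition 𝕜 m (R := (R : ℝ)) R.cast_nonneg
  set C₂ : ℝ := (2 * R + m + 1) ^ (n + 1) + (2 * R + 1) ^ (L + 1) * c + 2 ^ (L + 1) with hC₂
  have hC₂0 : 0 < C₂ := by positivity
  refine ⟨max k R, le_trans (by omega) (le_max_left k R), Q, hQ1, A * 4 ^ (m + 1) * C₂,
    by positivity, ε₀, hε₀.1, fun f ε hε hεε₀ => ?_⟩
  have hε1 : ε ≤ 1 := hεε₀.le.trans hε₀.2.le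
  -- The two representatives are independent, so the infima over `F` and over `G` can be taken
  -- separately afterwards.
  have main : ∀ F G : smoothFunctions 𝕜, Ideal.Quotient.mk I F = f → Ideal.Quotient.mk I G = f →
      quotientNorm I m f ≤ A * 4 ^ (m + 1) * C₂ * ((ε ^ ((2 * γ + 1) * Q))⁻¹ *
        smoothNorm (zeroSet I) n F + ε ^ Q * smoothNorm (zeroSet I) (max k R) G) := by
    intro F G hF hG
    have hFG : F - G ∈ I := Ideal.Quotient.eq.1 (hF.trans hG.symm)
    set δ : ℝ := ε ^ r / 4 with hδdef
    have hδ : 0 < δ := by positivity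
    have hδ1 : δ ≤ 1 := by
      have := pow_le_one₀ (n := r) hε.le hε1
      rw [hδdef]; linarith
    obtain ⟨N, u, hu, hglue⟩ := hA δ hδ hδ1
    choose H hH hHB using fun i : ℕ => exists_local_representative (m := m) hK hc hr
      (by omega : m ≤ L) hk
      (le_max_left k R) (le_max_right k R) (fun x hx => (hKR x hx).le) hε hε1 hδdef
      (fun x hx => h x hx ε hε hεε₀) hFG (u i)
    rw [← hF, ← mk_sum_smoothCell_mul hI hδ hKR hu F H hH]
    set BF := smoothNorm (zeroSet I) n F with hBFdef
    set BG := smoothNorm (zeroSet I) (max k R) G with hBGdef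
    have hBF0 : 0 ≤ BF := smoothNorm_nonneg _ _ _
    have hBG0 : 0 ≤ BG := smoothNorm_nonneg _ _ _
    refine (quotientNorm_mk_le I m _).trans (smoothNorm_le fun j hj t ht => ?_)
    have htR : |t| ≤ R := by
      rcases ht with ht | ht
      · exact (abs_le.2 (convexHull_subset_Icc hR₀ ht)).trans hR₀R.le
      · exact (abs_le.2 ht).trans hmR
    rw [coe_sum_smoothCell_mul]
    refine (hglue (fun i => H i) (fun i => contDiff_coe (H i)) _ (by positivity) hHB j hj t
      htR).trans ?_
    have hδpow : (δ ^ (m + 1))⁻¹ = 4 ^ (m + 1) * (ε ^ (r * (m + 1)))⁻¹ := by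
      rw [hδdef, div_pow, inv_div, ← pow_mul, div_eq_mul_inv]
    have h1 : (ε ^ (r * (m + 1)))⁻¹ * (ε ^ (γ * L))⁻¹ ≤ (ε ^ ((2 * γ + 1) * Q))⁻¹ := by
      rw [← mul_inv, ← pow_add]
      refine inv_anti₀ (by positivity) (pow_le_pow_of_le_one hε.le hε1 ?_)
      rw [hL]; nlinarith
    have h2 : (ε ^ (r * (m + 1)))⁻¹ * ε ^ (L + 1 - m) ≤ ε ^ Q := by
      have : L + 1 - m = r * (m + 1) + (Q + 1) := by omega
      rw [this, pow_add, inv_mul_cancel_left₀ (by positivity)]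
      exact pow_le_pow_of_le_one hε.le hε1 (by omega)
    rw [hδpow]
    calc A * (4 ^ (m + 1) * (ε ^ (r * (m + 1)))⁻¹) *
          (C₂ * ((ε ^ (γ * L))⁻¹ * BF + ε ^ (L + 1 - m) * BG))
        = A * 4 ^ (m + 1) * C₂ * (((ε ^ (r * (m + 1)))⁻¹ * (ε ^ (γ * L))⁻¹) * BF +
          ((ε ^ (r * (m + 1)))⁻¹ * ε ^ (L + 1 - m)) * BG) := by ring
      _ ≤ _ := by gcongr
  set C := A * 4 ^ (m + 1) * C₂ with hC
  have hC0 : 0 < C := by positivity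
  set α := (ε ^ ((2 * γ + 1) * Q))⁻¹ with hα
  have hα0 : 0 < α := by positivity
  have hβ0 : 0 < ε ^ Q := by positivity
  refine le_of_forall_pos_le_add fun η hη => ?_
  have hden : 0 < C * (α + ε ^ Q) := by positivity
  obtain ⟨F, hF, hFlt⟩ := exists_smoothNorm_lt I n f (div_pos hη hden)
  obtain ⟨G, hG, hGlt⟩ := exists_smoothNorm_lt I (max k R) f (div_pos hη hden)
  refine (main F G hF hG).trans ?_
  calc C * (α * smoothNorm (zeroSet I) n F + ε ^ Q * smoothNorm (zeroSet I) (max k R) G)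
      ≤ C * (α * (quotientNorm I n f + η / (C * (α + ε ^ Q))) +
        ε ^ Q * (quotientNorm I (max k R) f + η / (C * (α + ε ^ Q)))) := by gcongr
    _ = _ := by field_simp; ring

end GlobalEstimate

/-! ### Optimizing the scale and iterating. -/

section Interpolation

/-- For a > 0, taking ε proportional to ρ with ρ^(Q(A+1)) = a/b makes both terms multiples of ρ^Q b,
whose power of exponent A + 1 is a b^A. For a = 0 let ε tend to 0. -/
theorem pow_le_of_forall_scale_le {A Q : ℕ} (hQ : 1 ≤ Q) {C ε₀ : ℝ} (hC : 0 < C) (hε₀ : 0 < ε₀)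
    {a b c : ℝ} (ha : 0 ≤ a) (hab : a ≤ b) (hc : 0 ≤ c)
    (h : ∀ ε : ℝ, 0 < ε → ε < ε₀ → c ≤ C * ((ε ^ (A * Q))⁻¹ * a + ε ^ Q * b)) :
    c ^ (A + 1) ≤ (C * (((ε₀ / 2) ^ (A * Q))⁻¹ + (ε₀ / 2) ^ Q)) ^ (A + 1) * (a * b ^ A) := by
  rcases ha.eq_or_lt with rfl | ha
  · have hlim : Filter.Tendsto (fun ε : ℝ => C * (ε ^ Q * b)) (𝓝[>] 0) (𝓝 0) := by
      have : Continuous fun ε : ℝ => C * (ε ^ Q * b) := by fun_prop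
      have h0 := (this.tendsto 0).mono_left (nhdsWithin_le_nhds (s := Ioi 0))
      simpa [zero_pow (by omega : Q ≠ 0)] using h0
    have hc0 : c ≤ 0 := by
      refine ge_of_tendsto hlim ?_
      filter_upwards [Ioo_mem_nhdsGT hε₀] with ε hε
      simpa using h ε hε.1 hε.2
    rw [le_antisymm hc0 hc]; simp
  · have hb : 0 < b := ha.trans_le hab
    have hQA : Q * (A + 1) ≠ 0 := by positivity
    obtain ⟨ρ, hρ0, hρ⟩ : ∃ ρ : ℝ, 0 < ρ ∧ ρ ^ (Q * (A + 1)) = a / b :=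
      ⟨(a / b) ^ (((Q * (A + 1) : ℕ) : ℝ)⁻¹), by positivity,
        Real.rpow_inv_natCast_pow (by positivity) hQA⟩
    have hρ1 : ρ ≤ 1 := by
      rw [← pow_le_one_iff_of_nonneg hρ0.le hQA, hρ]
      exact (div_le_one hb).2 hab
    have haρ : a = ρ ^ (A * Q) * ρ ^ Q * b := by
      rw [← pow_add, show A * Q + Q = Q * (A + 1) by ring, hρ, div_mul_cancel₀ _ hb.ne']
    have h1 := h (ε₀ / 2 * ρ) (by positivity) (by nlinarith)
    have h2 : C * (((ε₀ / 2 * ρ) ^ (A * Q))⁻¹ * a + (ε₀ / 2 * ρ) ^ Q * b) =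
        C * (((ε₀ / 2) ^ (A * Q))⁻¹ + (ε₀ / 2) ^ Q) * (ρ ^ Q * b) := by
      conv_lhs => rw [haρ]
      rw [mul_pow, mul_pow, mul_inv]
      field_simp
    rw [h2] at h1
    refine (pow_le_pow_left₀ hc h1 (A + 1)).trans (le_of_eq ?_)
    rw [mul_pow _ (ρ ^ Q * b), mul_pow (ρ ^ Q), ← pow_mul, hρ, pow_succ b]
    congr 1
    field_simp

/-- Bernoulli's inequality for (1 + 1/A)^A. It shows that A iterations suffice to give the lower
norm half of the exponent. -/
theorem two_mul_pow_le_succ_pow {A : ℕ} (hA : 1 ≤ A) : 2 * A ^ A ≤ (A + 1) ^ A := by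
  have h1 : (0 : ℝ) < A := by exact_mod_cast hA
  have h2 := one_add_mul_le_pow (a := (1 : ℝ) / A) (by
    have : (0 : ℝ) ≤ 1 / A := by positivity
    linarith) A
  rw [mul_one_div_cancel h1.ne', show 1 + (1 : ℝ) / A = (A + 1) / A by field_simp, div_pow,
    le_div_iff₀ (by positivity)] at h2
  have h3 : (2 : ℝ) * A ^ A ≤ (A + 1) ^ A := by linarith
  exact_mod_cast h3

/-- After squaring, the surplus exponent u - v moves from a to b because a ≤ b, and a `w`-th root
can be taken. -/
theorem sq_le_of_pow_le {u v w : ℕ} (hw : u + v = w) (hvu : v ≤ u) (hw0 : w ≠ 0) {D a b c : ℝ}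
    (ha : 0 ≤ a) (hab : a ≤ b) (hc : 0 ≤ c) (h : c ^ w ≤ D * (a ^ u * b ^ v)) :
    c ^ 2 ≤ (D ^ 2 + 1) * (b * a) := by
  have hb : 0 ≤ b := ha.trans hab
  refine le_of_pow_le_pow_left₀ hw0 (by positivity) ?_
  obtain ⟨d, rfl⟩ := Nat.exists_eq_add_of_le hvu
  have h1 : (c ^ 2) ^ w ≤ D ^ 2 * (a ^ w * (a ^ d * b ^ (2 * v))) := by
    rw [← pow_mul, mul_comm 2 w, pow_mul]
    refine (pow_le_pow_left₀ (by positivity) h 2).trans (le_of_eq ?_)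
    subst hw; ring
  refine h1.trans ?_
  calc D ^ 2 * (a ^ w * (a ^ d * b ^ (2 * v))) ≤ D ^ 2 * (a ^ w * (b ^ d * b ^ (2 * v))) := by
        gcongr
    _ = D ^ 2 * (b * a) ^ w := by subst hw; ring
    _ ≤ (D ^ 2 + 1) ^ w * (b * a) ^ w := by
        gcongr
        exact (le_add_of_nonneg_right zero_le_one).trans
          (le_self_pow₀ (by nlinarith [sq_nonneg D]) hw0)
    _ = _ := by rw [← mul_pow]

/-- If an increasing sequence of seminorms satisfies interpolation inequalities with a fixed
exponent, then its `n`-th member is dominating. -/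
theorem isDominating_of_pow_le {X : Type*} {p : ℕ → X → ℝ} {n A : ℕ} (hA : 1 ≤ A)
    (h0 : ∀ m x, 0 ≤ p m x) (hmono : ∀ m k, m ≤ k → ∀ x, p m x ≤ p k x)
    (h : ∀ m : ℕ, ∃ k ≥ m, ∃ D > (0 : ℝ), ∀ x, p m x ^ (A + 1) ≤ D * (p n x * p k x ^ A)) :
    IsDominating p n := by
  -- After s rounds the upper norm has the share (A/(A+1))^s of the total exponent.
  have iter : ∀ s : ℕ, ∃ u, u + A ^ s = (A + 1) ^ s ∧ ∀ m : ℕ, ∃ k ≥ m, ∃ D > (0 : ℝ),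
      ∀ x, p m x ^ (A + 1) ^ s ≤ D * (p n x ^ u * p k x ^ A ^ s) := by
    intro s
    induction s with
    | zero => exact ⟨0, by simp, fun m => ⟨m, le_rfl, 1, one_pos, fun x => by simp⟩⟩
    | succ s ih =>
      obtain ⟨u, hu, ih⟩ := ih
      refine ⟨u * (A + 1) + A ^ s, by rw [pow_succ (A + 1), ← hu]; ring, fun m => ?_⟩
      obtain ⟨k, hk, D, hD, hkD⟩ := ih m
      obtain ⟨l, hl, E, hE, hlE⟩ := h k
      refine ⟨l, hk.le.trans hl, D ^ (A + 1) * E ^ A ^ s, by positivity, fun x => ?_⟩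
      have hn := h0 n x
      have hkx := h0 k x
      have hlx := h0 l x
      have hmx := h0 m x
      calc p m x ^ (A + 1) ^ (s + 1) = (p m x ^ (A + 1) ^ s) ^ (A + 1) := by
            rw [← pow_mul, pow_succ]
        _ ≤ (D * (p n x ^ u * p k x ^ A ^ s)) ^ (A + 1) := by gcongr; exact hkD x
        _ = D ^ (A + 1) * p n x ^ (u * (A + 1)) * (p k x ^ (A + 1)) ^ A ^ s := by
            rw [mul_pow, mul_pow, ← pow_mul, ← pow_mul, ← pow_mul, mul_comm (A ^ s)]; ring
        _ ≤ D ^ (A + 1) * p n x ^ (u * (A + 1)) * (E * (p n x * p l x ^ A)) ^ A ^ s := by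
            gcongr; exact hlE x
        _ = _ := by
            rw [mul_pow, mul_pow, ← pow_mul, pow_add, pow_succ' A]; ring
  obtain ⟨u, hu, hiter⟩ := iter A
  intro m hm
  obtain ⟨k, hk, D, hD, hkD⟩ := hiter m
  refine ⟨k, hk, D ^ 2 + 1, by positivity, fun x => ?_⟩
  have h2 := two_mul_pow_le_succ_pow hA
  rw [mul_assoc]
  exact sq_le_of_pow_le hu (by omega) (by positivity) (h0 n x)
    (hmono n k (hm.le.trans hk) x) (h0 m x) (hkD x)

end Interpolation

theorem theorem3p1 {𝕜 : Type*} [RCLike 𝕜] (I : Ideal (smoothFunctions 𝕜))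
    (hI : IsClosed[smoothTopology 𝕜] (I : Set (smoothFunctions 𝕜)))
    (hK : IsCompact (zeroSet I)) (n : ℕ) (h : FewZerosOrMarkov I n) :
    (∀ f : smoothFunctions 𝕜 ⧸ I, quotientNorm I n f = 0 → f = 0) ∧
      IsDominating (quotientNorm I) n := by
  have hdom : IsDominating (quotientNorm I) n := by
    obtain ⟨A, hA, hscale⟩ := exists_quotientNorm_le_scale hI hK h
    refine isDominating_of_pow_le hA (quotientNorm_nonneg I)
      (fun m k hmk f => quotientNorm_mono hK hmk f) fun m => ?_
    -- Starting from max(m, n) ensures k ≥ n, so that p_n ≤ p_k as the optimization in ε requires.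
    obtain ⟨k, hk, Q, hQ, C, hC, ε₀, hε₀, hs⟩ := hscale (max m n)
    refine ⟨k, (le_max_left m n).trans hk, _, ?_, fun f =>
      (pow_le_pow_left₀ (quotientNorm_nonneg I m f)
        (quotientNorm_mono hK (le_max_left m n) f) _).trans
      (pow_le_of_forall_scale_le hQ hC hε₀ (quotientNorm_nonneg I n f)
        (quotientNorm_mono hK ((le_max_right m n).trans hk) f) (quotientNorm_nonneg I _ f)
        (hs f))⟩
    positivity
  -- The dominating inequality forces every p_m(f) to vanish once p_n(f) does.
  refine ⟨fun f hf => eq_zero_of_quotientNorm_eq_zero hI hK fun m => ?_, hdom⟩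
  obtain ⟨k, -, c, -, hc⟩ := hdom (max m n) (le_max_right m n)
  have h1 := hc f
  rw [hf, mul_zero] at h1
  have h2 : quotientNorm I (max m n) f = 0 := by nlinarith [quotientNorm_nonneg I (max m n) f]
  exact le_antisymm ((quotientNorm_mono hK (le_max_left m n) f).trans h2.le)
    (quotientNorm_nonneg I m f)
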